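/- Let $k$ be a field of characteristic $p\ge 0$, let $n\ge 0$, and let $G$ be a subgroup of the symmetric group $S_n$, acting on $V=\mathbb{A}^n_k$ by permutation of the coordinates. Let $X=V/G=\operatorname{Spec} k[x_1,\dots,x_n]^G$ be the quotient variety and $\pi\colon V\to X$ the quotient map. There is a unique effective $\mathbb{Q}$-divisor $B$ on $X$ such that $\pi^*(K_X+B)=K_V$ (meaning that, for every nonzero rational top form $\omega$ on $X$, one has $\pi^*(\operatorname{div}\omega+B)=\operatorname{div}(\pi^*\omega)$ as $\mathbb{Q}$-divisors on $V$). This divisor $B$ has the following properties. 1. If $p\neq 2$, the multiplicity of $B$ at every irreducible component of its support is $1/2$. If $p=2$, the multiplicity of $B$ at every irreducible component of its support is $1$. 2. The $\mathbb{Q}$-divisor $B$ is $2$-Cartier, that is, $2B$ is Cartier. Moreover, if $p=2$, then $B$ itself is Cartier. -/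

import Mathlib

/-!
# The boundary divisor of a permutation quotient of affine space

`V = 𝔸ⁿ = Spec k[x₁, …, xₙ]`, `G ≤ Sₙ` permutes the coordinates, and `X = V / G` is the normal affine
variety `Spec k[x₁, …, xₙ]^G`.  Both are treated through their coordinate rings.  For a domain `A`
that is a `k`-algebra, a rational top form on `Spec A` is an element of `⋀ⁿ Ω[Frac A ⁄ k]`.
-/

namespace PermQuotient

noncomputable section

/-! ### Prime divisors and Weil divisors on an affine variety -/

/-- A prime divisor on `Spec A`: a prime ideal of height one. -/
@[ext] structure PrimeDivisor (A : Type*) [CommRing A] where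
  /-- the ideal of functions vanishing on the divisor -/
  asIdeal : Ideal A
  isPrime : asIdeal.IsPrime
  height_eq_one : asIdeal.height = 1

attribute [instance] PrimeDivisor.isPrime

/-- A `ℚ`-divisor on `Spec A`: a finite `ℚ`-linear combination of prime divisors. -/
abbrev QDivisor (A : Type*) [CommRing A] : Type _ := PrimeDivisor A →₀ ℚ

/-- A Weil divisor on `Spec A` with integer coefficients. -/
abbrev WeilDivisor (A : Type*) [CommRing A] : Type _ := PrimeDivisor A →₀ ℤ

/-- A Weil divisor regarded as a `ℚ`-divisor. -/
def WeilDivisor.toQ {A : Type*} [CommRing A] (D : WeilDivisor A) : QDivisor A :=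
  D.mapRange (fun m : ℤ => (m : ℚ)) Int.cast_zero

section OrderOfVanishing

variable {A : Type*} [CommRing A] [IsDomain A]

/-- The local ring of `Spec A` at the generic point of `P`, as the subring
`{a / s | a ∈ A, s ∈ A \ P}` of the function field. -/
def PrimeDivisor.localRing (P : PrimeDivisor A) : Subalgebra A (FractionRing A) :=
  Localization.subalgebra.ofField (FractionRing A) P.asIdeal.primeCompl
    P.asIdeal.primeCompl_le_nonZeroDivisors

/-- The order of a rational function `f = a / b` (with `a`, `b` in the local ring at `P`) along the
prime divisor `P`: the order of vanishing of `a` minus that of `b`.  It is only used for `f ≠ 0`;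
for Noetherian `A` it does not depend on the representation of `f` as a fraction. -/
def PrimeDivisor.ord (P : PrimeDivisor A) (f : FractionRing A) : ℤ :=
  let s := IsLocalization.sec (nonZeroDivisors P.localRing) f
  ((Ring.ord P.localRing s.1).toNat : ℤ) - ((Ring.ord P.localRing (s.2 : P.localRing)).toNat : ℤ)

/-- A `ℚ`-divisor on `Spec A` is Cartier if, locally in the Zariski topology, it is the divisor of a
nonzero rational function (in particular its coefficients are then integers). -/
def QDivisor.IsCartier (D : QDivisor A) : Prop :=
  ∀ x : PrimeSpectrum A, ∃ g : A, g ∉ x.asIdeal ∧ ∃ f : FractionRing A, f ≠ 0 ∧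
    ∀ P : PrimeDivisor A, g ∉ P.asIdeal → D P = (P.ord f : ℚ)

/-- A `ℚ`-divisor `D` is `m`-Cartier if `m D` is Cartier. -/
def QDivisor.IsNCartier (m : ℕ) (D : QDivisor A) : Prop :=
  QDivisor.IsCartier (m • D)

end OrderOfVanishing

/-! ### Rational top forms and canonical divisors -/

/-- Differential `n`-forms of a field extension `K / k`.  If `K` is the function field of an
`n`-dimensional variety, these are its rational top forms. -/
abbrev Forms (k K : Type*) [Field k] [Field K] [Algebra k K] (n : ℕ) : Type _ :=
  ⋀[K]^n (Ω[K⁄k])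

section Canonical

variable (k : Type*) [Field k] {A : Type*} [CommRing A] [IsDomain A] [Algebra k A]

/-- The stalk at (the generic point of) `P` of the sheaf of `n`-forms that are regular there: the
image of `⋀ⁿ Ω[A_P ⁄ k]` in the rational `n`-forms, that is, the `A_P`-span of the forms
`da₁ ∧ ⋯ ∧ daₙ` with `a₁, …, aₙ ∈ A_P`. If `A_P` is smooth over `k` and `n = dim A`, this is the
stalk at `P` of the canonical sheaf. -/
def PrimeDivisor.regularForms (n : ℕ) (P : PrimeDivisor A) :
    Submodule P.localRing (Forms k (FractionRing A) n) :=
  Submodule.span P.localRing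
    (Set.range fun a : Fin n → P.localRing =>
      exteriorPower.ιMulti (FractionRing A) n
        fun i => KaehlerDifferential.D k (FractionRing A) (a i : FractionRing A))

/-- `D` is the divisor of the rational `n`-form `ω`: for every prime divisor `P` one can write
`ω = f η` with `η` a generator of the regular `n`-forms at `P` and `ord_P f` the coefficient of `D`
at `P`.  When `n` is the dimension and `ω ≠ 0`, such a `D` is a canonical divisor of `Spec A`. -/
def IsDivisorOfForm (n : ℕ) (ω : Forms k (FractionRing A) n) (D : WeilDivisor A) : Prop :=
  ∀ P : PrimeDivisor A, ∃ (η : Forms k (FractionRing A) n) (f : FractionRing A),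
    Submodule.span P.localRing {η} = P.regularForms k n ∧ ω = f • η ∧ P.ord f = D P

end Canonical

/-! ### Pullbacks -/

section Pullback

/-- Pullback of `n`-forms along a field extension `L / K`:
`c · df₁ ∧ ⋯ ∧ dfₙ ↦ c · df₁ ∧ ⋯ ∧ dfₙ`. -/
def pullbackForm (k K L : Type*) [Field k] [Field K] [Field L] [Algebra k K] [Algebra k L]
    [Algebra K L] [IsScalarTower k K L] (n : ℕ) : Forms k K n →ₗ[K] Forms k L n :=
  exteriorPower.alternatingMapLinearEquiv
    (AlternatingMap.compLinearMap
      ({ (exteriorPower.ιMulti L n (M := Ω[L⁄k])).toMultilinearMap.restrictScalars K with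
          map_eq_zero_of_eq' := fun v _ _ h hij =>
            (exteriorPower.ιMulti L n (M := Ω[L⁄k])).map_eq_zero_of_eq v h hij } :
        (Ω[L⁄k]) [⋀^Fin n]→ₗ[K] Forms k L n)
      (KaehlerDifferential.map k k K L))

/-- Pullback of rational `n`-forms along the dominant morphism `Spec S → Spec A` given by an injective
homomorphism of domains `A → S`. -/
def pullbackRationalForm (k : Type*) {A : Type*} (S : Type*) [Field k] [CommRing A] [IsDomain A]
    [CommRing S] [IsDomain S] [Algebra k A] [Algebra k S] [Algebra A S] [IsScalarTower k A S]
    [FaithfulSMul A S] (n : ℕ) (ω : Forms k (FractionRing A) n) : Forms k (FractionRing S) n :=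
  letI : Algebra (FractionRing A) (FractionRing S) := FractionRing.liftAlgebra A (FractionRing S)
  haveI : IsScalarTower A (FractionRing A) (FractionRing S) :=
    FractionRing.isScalarTower_liftAlgebra A (FractionRing S)
  haveI : IsScalarTower k (FractionRing A) (FractionRing S) :=
    IsScalarTower.of_algebraMap_eq fun c => by
      rw [IsScalarTower.algebraMap_apply k A (FractionRing A),
        ← IsScalarTower.algebraMap_apply A (FractionRing A) (FractionRing S),
        ← IsScalarTower.algebraMap_apply k A (FractionRing S)]
  pullbackForm k (FractionRing A) (FractionRing S) n ω

open scoped Classical in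
/-- Pullback of `ℚ`-divisors along the morphism `Spec S → Spec A` given by a finite extension
`A → S` of normal domains: the coefficient at `Q` of the pullback of a prime divisor `P` is the
ramification index of `Q` over `A` if `Q` lies over `P`, and zero otherwise. -/
def pullbackCoeff {A S : Type*} [CommRing A] [CommRing S] [Algebra A S] (D : QDivisor A)
    (Q : PrimeDivisor S) : ℚ :=
  D.sum fun P b => if Q.asIdeal.under A = P.asIdeal then (Q.asIdeal.ramificationIdx A : ℚ) * b else 0

end Pullback

/-! ### The quotient `X = V / G` and its boundary -/

section Quotient

variable (k : Type*) [Field k] {n : ℕ} (G : Subgroup (Equiv.Perm (Fin n)))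

/-- The coordinate ring of `X = 𝔸ⁿ / G`: the polynomials that are invariant under all permutations
of the variables in `G`. -/
def invariantRing : Subalgebra k (MvPolynomial (Fin n) k) where
  carrier := {f | ∀ σ ∈ G, MvPolynomial.rename σ f = f}
  mul_mem' hf hg σ hσ := by rw [map_mul, hf σ hσ, hg σ hσ]
  add_mem' hf hg σ hσ := by rw [map_add, hf σ hσ, hg σ hσ]
  algebraMap_mem' c σ _ := by rw [AlgHom.commutes]

/-- `π^*(K_X + B) = K_V` for the quotient map `π : V → X`: for every nonzero rational top form `ω` on
`X`, the canonical divisors `K_X = div ω` and `K_V = div (π^* ω)` exist and satisfy this equality of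
`ℚ`-divisors on `V`. -/
def IsCrepantBoundary (B : QDivisor (invariantRing k G)) : Prop :=
  ∀ ω : Forms k (FractionRing (invariantRing k G)) n, ω ≠ 0 →
    ∃ (KX : WeilDivisor (invariantRing k G)) (KV : WeilDivisor (MvPolynomial (Fin n) k)),
      IsDivisorOfForm k n ω KX ∧
      IsDivisorOfForm k n (pullbackRationalForm k (MvPolynomial (Fin n) k) n ω) KV ∧
      ∀ Q : PrimeDivisor (MvPolynomial (Fin n) k), pullbackCoeff (KX.toQ + B) Q = (KV Q : ℚ)

/-- `B` is the boundary of `X = V / G`: an effective `ℚ`-divisor with `π^*(K_X + B) = K_V`. -/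
def IsBoundary (B : QDivisor (invariantRing k G)) : Prop :=
  (∀ P, 0 ≤ B P) ∧ IsCrepantBoundary k G B

end Quotient

end

end PermQuotient

/-! The proof is a Hurwitz formula `K_V = π^* K_X + R` valid in every characteristic. At a prime
divisor `Q` of `V` over `P`, with ramification index `e`, it turns `π^*(K_X + B) = K_V` into `e * B
P = R_Q` (`isCrepantBoundary_iff`). So everything rests on one computation: `R` is the sum, with
multiplicity one, of the mirrors `x_i = x_j` of the transpositions `(i j)` in `G`. The different
would give this only after a separate analysis of wild ramification in characteristic two; Jacobians
treat all characteristics alike.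

The regular forms at `P` are spanned by the `da₁ ∧ ⋯ ∧ daₙ` with invariant `aᵢ`, and such a form
pulls back to the Jacobian of the `aᵢ` times the volume form. Hence `R_Q` is the least order along
`Q` of a Jacobian of invariants. On a mirror all these Jacobians vanish, as two columns agree there
(`jacobian_mem_of_isMirror`). That the order is no larger follows from
`exists_notMem_mul_jacobian_mem`: if the `G`-translates of a homomorphism `φ` that differ from `φ`
still differ from it modulo `Q`, then, up to a factor outside `Q`, the Jacobian of `φ` is a
combination of Jacobians of invariants. Off the mirrors one takes `φ = id`, with Jacobian `1`; on a
mirror one takes the quotient map by the transposition, with Jacobian `x_i - x_j`.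

The product of `x_i - x_j` over all ordered pairs with `(i j)` in `G` is invariant and has divisor
`2R` on `V`, so `2B` is its divisor on `X`; this gives existence, uniqueness and the Cartier
property of `2B`. In characteristic two the product over `i < j` is already invariant, and `B` is
its divisor. These functions also show that on a mirror `e` divides `2`, and that `e = 1` in
characteristic two. In the other characteristics `e ≠ 1`, because an invariant divisible by `x_i -
x_j` is divisible by its square. So `B P = 1 / e` is `1/2` or `1`. -/

namespace PermQuotient

noncomputable section

/-! ### Orders of vanishing on a normal Noetherian domain -/

namespace PrimeDivisor

section Order

variable {A : Type*} [CommRing A] [IsDomain A] (P : PrimeDivisor A)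

instance isLocalization_localRing : IsLocalization.AtPrime P.localRing P.asIdeal :=
  Localization.subalgebra.isLocalization_ofField _ _ _

instance isFractionRing_localRing : IsFractionRing P.localRing (FractionRing A) :=
  Localization.subalgebra.isFractionRing_ofField _ _ _

theorem mem_localRing_iff {x : FractionRing A} :
    x ∈ P.localRing ↔ ∃ a s : A, s ∉ P.asIdeal ∧
      x = algebraMap A (FractionRing A) a / algebraMap A (FractionRing A) s := by
  simp only [div_eq_mul_inv]
  constructor
  · rintro ⟨a, s, hs, h⟩
    exact ⟨a, s, hs, h⟩
  · rintro ⟨a, s, hs, h⟩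
    exact ⟨a, s, hs, h⟩

omit [IsDomain A] in
theorem algebraMap_ne_zero_of_notMem {s : A} (hs : s ∉ P.asIdeal) :
    algebraMap A (FractionRing A) s ≠ 0 := by
  rw [Ne, FaithfulSMul.algebraMap_eq_zero_iff]
  rintro rfl
  exact hs (zero_mem _)

theorem exists_localRing_div {f : FractionRing A} (hf : f ≠ 0) :
    ∃ x y : P.localRing, x ≠ 0 ∧ y ≠ 0 ∧ f * algebraMap P.localRing (FractionRing A) y =
      algebraMap P.localRing (FractionRing A) x := by
  obtain ⟨x, y, hy, rfl⟩ := IsFractionRing.div_surjective P.localRing f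
  have hy0 : algebraMap P.localRing (FractionRing A) y ≠ 0 := by
    simpa using nonZeroDivisors.ne_zero hy
  refine ⟨x, y, ?_, nonZeroDivisors.ne_zero hy, div_mul_cancel₀ _ hy0⟩
  rintro rfl
  simp at hf

theorem isUnit_localRing {s : A} (hs : s ∉ P.asIdeal) : IsUnit (algebraMap A P.localRing s) :=
  IsLocalization.map_units P.localRing (⟨s, hs⟩ : P.asIdeal.primeCompl)

/-- A local equation of the prime divisor `P` at its generic point. -/
def IsUniformizer (t : A) : Prop := Irreducible (algebraMap A P.localRing t)

theorem IsUniformizer.ne_zero {P : PrimeDivisor A} {t : A} (ht : P.IsUniformizer t) :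
    algebraMap A (FractionRing A) t ≠ 0 := by
  have := Irreducible.ne_zero ht
  rw [Ne, FaithfulSMul.algebraMap_eq_zero_iff] at this ⊢
  exact this

variable [IsNoetherianRing A] [IsIntegrallyClosed A]

/-- Localization preserves Noetherian and integrally closed, and height one gives Krull dimension
one, so the maximal ideal is the only nonzero prime. -/
instance isDiscreteValuationRing_localRing : IsDiscreteValuationRing P.localRing := by
  have hloc : IsLocalRing P.localRing := IsLocalization.AtPrime.isLocalRing _ P.asIdeal
  have hn : IsNoetherianRing P.localRing :=
    IsLocalization.isNoetherianRing P.asIdeal.primeCompl _ inferInstance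
  have hic : IsIntegrallyClosed P.localRing :=
    isIntegrallyClosed_of_isLocalization _ P.asIdeal.primeCompl
      P.asIdeal.primeCompl_le_nonZeroDivisors
  have hdim : ringKrullDim P.localRing = 1 := by
    rw [IsLocalization.AtPrime.ringKrullDim_eq_height P.asIdeal, P.height_eq_one]; rfl
  have hk : Ring.KrullDimLE 1 P.localRing := by
    rw [Ring.krullDimLE_iff, hdim]; rfl
  have hf : ¬ IsField P.localRing := fun h => by
    rw [ringKrullDim_eq_zero_of_isField h] at hdim
    exact zero_ne_one hdim
  have hne : IsLocalRing.maximalIdeal P.localRing ≠ ⊥ := fun h =>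
    hf (IsLocalRing.isField_iff_maximalIdeal_eq.mpr h)
  have tfae : IsDiscreteValuationRing P.localRing ↔ IsIntegrallyClosed P.localRing ∧
      ∃! I : Ideal P.localRing, I ≠ ⊥ ∧ I.IsPrime :=
    (IsDiscreteValuationRing.TFAE P.localRing hf).out 0 3
  refine tfae.mpr ⟨hic, _, ⟨hne, inferInstance⟩, fun I hI => ?_⟩
  have := hI.2
  exact IsLocalRing.eq_maximalIdeal (hI.2.isMaximal_of_ne_bot hI.1)

/-- Cross-multiplying two representations and using additivity of `Ring.ord` frees `ord` from the
chosen fraction; orders of nonzero elements are finite, so `toNat` loses nothing. -/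
theorem ord_eq_sub {f : FractionRing A} {x y : P.localRing} (hx : x ≠ 0) (hy : y ≠ 0)
    (h : f * algebraMap P.localRing (FractionRing A) y =
      algebraMap P.localRing (FractionRing A) x) :
    P.ord f = ((Ring.ord P.localRing x).toNat : ℤ) - ((Ring.ord P.localRing y).toNat : ℤ) := by
  unfold PrimeDivisor.ord
  set s := IsLocalization.sec (nonZeroDivisors P.localRing) f with hs
  have hspec := IsLocalization.sec_spec (nonZeroDivisors P.localRing) f
  rw [← hs] at hspec
  have hs2 : (s.2 : P.localRing) ≠ 0 := nonZeroDivisors.ne_zero s.2.2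
  have key : s.1 * y = x * s.2 := by
    apply IsFractionRing.injective P.localRing (FractionRing A)
    rw [map_mul, map_mul, ← hspec, ← h]
    ring
  have hs1 : s.1 ≠ 0 := by
    intro h0
    rw [h0, zero_mul] at key
    exact mul_ne_zero hx hs2 key.symm
  have e := congrArg (fun z => (Ring.ord P.localRing z).toNat) key
  have fin : ∀ z : P.localRing, z ≠ 0 → Ring.ord P.localRing z ≠ ⊤ := fun z hz =>
    Ring.ord_ne_top (mem_nonZeroDivisors_of_ne_zero hz)
  rw [Ring.ord_mul _ (mem_nonZeroDivisors_of_ne_zero hy),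
    Ring.ord_mul _ (mem_nonZeroDivisors_of_ne_zero hs2), ENat.toNat_add (fin _ hs1) (fin _ hy),
    ENat.toNat_add (fin _ hx) (fin _ hs2)] at e
  change ((Ring.ord P.localRing s.1).toNat : ℤ) -
    ((Ring.ord P.localRing (s.2 : P.localRing)).toNat : ℤ) = _
  omega

theorem ord_mul {f g : FractionRing A} (hf : f ≠ 0) (hg : g ≠ 0) :
    P.ord (f * g) = P.ord f + P.ord g := by
  obtain ⟨x, y, hx, hy, h⟩ := P.exists_localRing_div hf
  obtain ⟨z, w, hz, hw, h'⟩ := P.exists_localRing_div hg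
  have fin : ∀ z : P.localRing, z ≠ 0 → Ring.ord P.localRing z ≠ ⊤ := fun z hz =>
    Ring.ord_ne_top (mem_nonZeroDivisors_of_ne_zero hz)
  rw [P.ord_eq_sub hx hy h, P.ord_eq_sub hz hw h',
    P.ord_eq_sub (mul_ne_zero hx hz) (mul_ne_zero hy hw)
      (by rw [map_mul, map_mul, ← h, ← h']; ring),
    Ring.ord_mul _ (mem_nonZeroDivisors_of_ne_zero hz),
    Ring.ord_mul _ (mem_nonZeroDivisors_of_ne_zero hw), ENat.toNat_add (fin _ hx) (fin _ hz),
    ENat.toNat_add (fin _ hy) (fin _ hw)]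
  push_cast
  ring

theorem ord_localRing {x : P.localRing} (hx : x ≠ 0) :
    P.ord (x : FractionRing A) = ((Ring.ord P.localRing x).toNat : ℤ) := by
  rw [P.ord_eq_sub hx one_ne_zero (by rw [map_one, mul_one]; rfl)]
  simp

theorem ord_one : P.ord (1 : FractionRing A) = 0 := by
  have := P.ord_mul (one_ne_zero (α := FractionRing A)) one_ne_zero
  rw [mul_one] at this
  omega

theorem ord_inv {f : FractionRing A} (hf : f ≠ 0) : P.ord f⁻¹ = - P.ord f := by
  have := P.ord_mul hf (inv_ne_zero hf)
  rw [mul_inv_cancel₀ hf, ord_one] at this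
  omega

theorem ord_div {f g : FractionRing A} (hf : f ≠ 0) (hg : g ≠ 0) :
    P.ord (f / g) = P.ord f - P.ord g := by
  rw [div_eq_mul_inv, P.ord_mul hf (inv_ne_zero hg), P.ord_inv hg, sub_eq_add_neg]

theorem ord_pow {f : FractionRing A} (hf : f ≠ 0) (m : ℕ) : P.ord (f ^ m) = m * P.ord f := by
  induction m with
  | zero => simp [ord_one]
  | succ m ih =>
    rw [pow_succ, P.ord_mul (pow_ne_zero _ hf) hf, ih]
    push_cast
    ring

theorem ord_zpow {f : FractionRing A} (hf : f ≠ 0) (m : ℤ) : P.ord (f ^ m) = m * P.ord f := by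
  cases m with
  | ofNat m => simpa using P.ord_pow hf m
  | negSucc m =>
    rw [zpow_negSucc, P.ord_inv (pow_ne_zero _ hf), P.ord_pow hf, Int.negSucc_eq]
    push_cast
    ring

theorem ord_eq_zero_of_notMem {s : A} (hs : s ∉ P.asIdeal) :
    P.ord (algebraMap A (FractionRing A) s) = 0 := by
  have h := P.ord_localRing (P.isUnit_localRing hs).ne_zero
  rwa [Ring.ord_of_isUnit (P.isUnit_localRing hs)] at h

theorem ord_nonneg {f : FractionRing A} (hf : f ≠ 0) (h : f ∈ P.localRing) : 0 ≤ P.ord f := by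
  have := P.ord_localRing (x := ⟨f, h⟩) (by simpa [Subtype.ext_iff] using hf)
  simp only at this
  rw [this]
  exact Int.natCast_nonneg _

theorem exists_isUniformizer : ∃ t, P.IsUniformizer t := by
  obtain ⟨x, hx⟩ := IsDiscreteValuationRing.exists_irreducible P.localRing
  obtain ⟨⟨t, s⟩, h⟩ := IsLocalization.surj P.asIdeal.primeCompl x
  refine ⟨t, ?_⟩
  unfold IsUniformizer
  rw [← h]
  exact (irreducible_mul_isUnit (IsLocalization.map_units P.localRing s)).mpr hx

variable {P}

theorem IsUniformizer.ord_eq {t : A} (ht : P.IsUniformizer t) :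
    P.ord (algebraMap A (FractionRing A) t) = 1 := by
  have h := P.ord_localRing (Irreducible.ne_zero ht)
  rwa [Ring.ord_of_irreducible ht] at h

theorem IsUniformizer.map_asIdeal {t : A} (ht : P.IsUniformizer t) :
    P.asIdeal.map (algebraMap A P.localRing) = Ideal.span {algebraMap A P.localRing t} := by
  have := IsLocalization.AtPrime.isLocalRing P.localRing P.asIdeal
  rw [IsLocalization.AtPrime.map_eq_maximalIdeal P.asIdeal P.localRing]
  exact (IsDiscreteValuationRing.irreducible_iff_uniformizer _).mp ht

variable (P)

theorem exists_notMem_mul_eq {t : A} (ht : P.IsUniformizer t) {f : FractionRing A} (hf : f ≠ 0) :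
    ∃ a b : A, a ∉ P.asIdeal ∧ b ∉ P.asIdeal ∧
      f = algebraMap A _ t ^ P.ord f * (algebraMap A _ a / algebraMap A _ b) := by
  obtain ⟨n, u, hu⟩ :=
    IsDiscreteValuationRing.exists_units_eq_smul_zpow_of_irreducible ht hf
  rw [← IsScalarTower.algebraMap_apply A P.localRing (FractionRing A), Units.smul_def,
    Algebra.smul_def] at hu
  obtain ⟨a, b, hb, hab⟩ := P.mem_localRing_iff.mp (u : P.localRing).2
  have hb0 := P.algebraMap_ne_zero_of_notMem hb
  have ha : a ∉ P.asIdeal := by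
    intro ha
    have := IsLocalization.AtPrime.isLocalRing P.localRing P.asIdeal
    have h1 : algebraMap A P.localRing a ∈ IsLocalRing.maximalIdeal P.localRing :=
      (IsLocalization.AtPrime.to_map_mem_maximal_iff P.localRing P.asIdeal a).mpr ha
    have h2 : algebraMap A P.localRing a = u * algebraMap A P.localRing b := by
      apply Subtype.ext
      change algebraMap A (FractionRing A) a = ((u : P.localRing) : FractionRing A) *
        algebraMap A (FractionRing A) b
      rw [hab, div_mul_cancel₀ _ hb0]
    rw [h2] at h1
    exact h1 (u.isUnit.mul (P.isUnit_localRing hb))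
  have hn : P.ord f = n := by
    rw [hu, P.ord_mul _ (zpow_ne_zero _ ht.ne_zero), P.ord_zpow ht.ne_zero, ht.ord_eq]
    · have : P.ord (algebraMap P.localRing (FractionRing A) u) = 0 := by
        have := P.ord_localRing u.ne_zero
        rw [Ring.ord_of_isUnit u.isUnit] at this
        exact this
      rw [this]
      ring
    · simp
  refine ⟨a, b, ha, hb, ?_⟩
  rw [hn, ← hab, hu, mul_comm]
  rfl

theorem mem_localRing_of_ord_nonneg {f : FractionRing A} (h : 0 ≤ P.ord f) :
    f ∈ P.localRing := by
  by_cases hf : f = 0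
  · exact hf ▸ zero_mem _
  obtain ⟨t, ht⟩ := P.exists_isUniformizer
  obtain ⟨a, b, -, hb, e⟩ := P.exists_notMem_mul_eq ht hf
  obtain ⟨n, hn⟩ := Int.eq_ofNat_of_zero_le h
  rw [e, hn]
  refine P.mem_localRing_iff.mpr ⟨t ^ n * a, b, hb, ?_⟩
  simp [mul_div_assoc]

theorem ord_pos_of_mem {a : A} (h0 : a ≠ 0) (h : a ∈ P.asIdeal) :
    0 < P.ord (algebraMap A (FractionRing A) a) := by
  have := IsLocalization.AtPrime.isLocalRing P.localRing P.asIdeal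
  have ha : algebraMap A (FractionRing A) a ≠ 0 := by simpa using h0
  refine lt_of_le_of_ne (P.ord_nonneg ha (algebraMap_mem _ a)) fun h' => ?_
  have h1 := P.ord_inv ha
  rw [← h', neg_zero] at h1
  have h2 := P.mem_localRing_of_ord_nonneg h1.ge
  have h3 : algebraMap A P.localRing a ∈ IsLocalRing.maximalIdeal P.localRing :=
    (IsLocalization.AtPrime.to_map_mem_maximal_iff P.localRing P.asIdeal a).mpr h
  refine h3 (IsUnit.of_mul_eq_one ⟨_, h2⟩ (Subtype.ext ?_))
  exact mul_inv_cancel₀ ha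

theorem isUniformizer_of_asIdeal_eq_span {t : A} (h : P.asIdeal = Ideal.span {t}) :
    P.IsUniformizer t := by
  have := IsLocalization.AtPrime.isLocalRing P.localRing P.asIdeal
  refine (IsDiscreteValuationRing.irreducible_iff_uniformizer _).mpr ?_
  rw [← IsLocalization.AtPrime.map_eq_maximalIdeal P.asIdeal P.localRing, h, Ideal.map_span,
    Set.image_singleton]

end Order

/-! ### Ramification indices as orders of pulled-back functions -/

section Ramification

/-- Needed because the ramification index is computed in `Localization.AtPrime` and `ord` in a
subring of the fraction field. -/
theorem ord_ringEquiv {R R' : Type*} [CommRing R] [CommRing R'] (e : R ≃+* R')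
    (x : R) : Ring.ord R' (e x) = Ring.ord R x := by
  have h : Ideal.span {e x} = e.symm.idealComapOrderIso (Ideal.span {x}) := by
    rw [RingEquiv.idealComapOrderIso_apply, Ideal.comap_symm, Ideal.map_span, Set.image_singleton]
  rw [Ring.ord, Ring.ord, Module.length_quotient, Module.length_quotient, h,
    Order.coheight_orderIso]

theorem ord_localization {S : Type*} [CommRing S] [IsDomain S] (Q : PrimeDivisor S) (x : S) :
    Ring.ord (Localization.AtPrime Q.asIdeal) (algebraMap S (Localization.AtPrime Q.asIdeal) x) =
      Ring.ord Q.localRing (algebraMap S Q.localRing x) := by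
  have e := IsLocalization.algEquiv Q.asIdeal.primeCompl (Localization.AtPrime Q.asIdeal)
    Q.localRing
  rw [← ord_ringEquiv e.toRingEquiv]
  exact congrArg _ (e.commutes x)

variable {A S : Type*} [CommRing A] [IsDomain A] [IsNoetherianRing A] [IsIntegrallyClosed A]
  [CommRing S] [IsDomain S] [IsNoetherianRing S] [IsIntegrallyClosed S] [Algebra A S]
  [FaithfulSMul A S] {P : PrimeDivisor A} {Q : PrimeDivisor S}

/-- The index is the length of `S_Q / P S_Q`, and `P S_Q` is generated by `t` because elements of
`A` outside `P` become units in `S_Q`. -/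
theorem IsUniformizer.ramificationIdx_eq {t : A} (ht : P.IsUniformizer t)
    (hPQ : Q.asIdeal.under A = P.asIdeal) :
    (Q.asIdeal.ramificationIdx A : ℤ) =
      Q.ord (algebraMap S (FractionRing S) (algebraMap A S t)) := by
  let SQ := Localization.AtPrime Q.asIdeal
  have hnot : ∀ s : A, s ∉ P.asIdeal → algebraMap A S s ∉ Q.asIdeal := fun s hs h =>
    hs (hPQ ▸ h)
  have hmap : P.asIdeal.map (algebraMap A SQ) = Ideal.span {algebraMap A SQ t} := by
    apply le_antisymm
    · rw [Ideal.map_le_iff_le_comap]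
      intro x hx
      have hx' : algebraMap A P.localRing x ∈ Ideal.span {algebraMap A P.localRing t} :=
        ht.map_asIdeal ▸ Ideal.mem_map_of_mem _ hx
      obtain ⟨c, hc⟩ := Ideal.mem_span_singleton'.mp hx'
      obtain ⟨⟨a, s⟩, h⟩ := IsLocalization.surj P.asIdeal.primeCompl c
      have h' : a * t = s * x := by
        apply FaithfulSMul.algebraMap_injective A P.localRing
        rw [map_mul, map_mul, ← hc, ← h]
        ring
      have hs : IsUnit (algebraMap A SQ s) := by
        rw [IsScalarTower.algebraMap_apply A S SQ]
        exact IsLocalization.map_units SQ (⟨_, hnot s s.2⟩ : Q.asIdeal.primeCompl)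
      rw [Ideal.mem_comap, ← Ideal.unit_mul_mem_iff_mem _ hs, ← map_mul, ← h', map_mul]
      exact Ideal.mul_mem_left _ _ (Ideal.mem_span_singleton_self _)
    · rw [Ideal.span_singleton_le_iff_mem]
      have : t ∈ P.asIdeal := by
        by_contra h
        have h1 := P.ord_eq_zero_of_notMem h
        rw [ht.ord_eq] at h1
        exact one_ne_zero h1
      exact Ideal.mem_map_of_mem _ this
  rw [Ideal.ramificationIdx_def, hPQ]
  change (((Module.length SQ (SQ ⧸ P.asIdeal.map (algebraMap A SQ))).toNat : ℕ) : ℤ) = _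
  rw [hmap]
  change (((Ring.ord SQ (algebraMap A SQ t)).toNat : ℕ) : ℤ) = _
  have h0 : algebraMap S Q.localRing (algebraMap A S t) ≠ 0 := by
    simpa using ht.ne_zero
  have h1 := Q.ord_localRing h0
  rw [IsScalarTower.algebraMap_apply A S SQ, Q.ord_localization, ← h1]
  rfl

theorem ord_algebraMap_eq [Algebra (FractionRing A) (FractionRing S)]
    [IsScalarTower A (FractionRing A) (FractionRing S)]
    (hPQ : Q.asIdeal.under A = P.asIdeal) {f : FractionRing A} (hf : f ≠ 0) :
    Q.ord (algebraMap (FractionRing A) (FractionRing S) f) =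
      Q.asIdeal.ramificationIdx A * P.ord f := by
  obtain ⟨t, ht⟩ := P.exists_isUniformizer
  obtain ⟨a, b, ha, hb, e⟩ := P.exists_notMem_mul_eq ht hf
  have hnot : ∀ s : A, s ∉ P.asIdeal → algebraMap A S s ∉ Q.asIdeal := fun s hs h =>
    hs (hPQ ▸ h)
  have hcomp : ∀ s : A, algebraMap (FractionRing A) (FractionRing S)
      (algebraMap A (FractionRing A) s) = algebraMap S (FractionRing S) (algebraMap A S s) := by
    intro s
    rw [← IsScalarTower.algebraMap_apply, ← IsScalarTower.algebraMap_apply]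
  have ht0 : algebraMap S (FractionRing S) (algebraMap A S t) ≠ 0 := by
    simpa using ht.ne_zero
  have ha0 := Q.algebraMap_ne_zero_of_notMem (hnot a ha)
  have hb0 := Q.algebraMap_ne_zero_of_notMem (hnot b hb)
  conv_lhs => rw [e]
  rw [map_mul, map_zpow₀, map_div₀, hcomp, hcomp, hcomp, Q.ord_mul (zpow_ne_zero _ ht0)
    (div_ne_zero ha0 hb0), Q.ord_zpow ht0, Q.ord_div ha0 hb0, Q.ord_eq_zero_of_notMem (hnot a ha),
    Q.ord_eq_zero_of_notMem (hnot b hb), ht.ramificationIdx_eq hPQ]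
  ring

end Ramification

end PrimeDivisor


/-! ### Prime divisors in integral extensions -/

namespace PrimeDivisor

section Integral

variable {A S : Type*} [CommRing A] [IsDomain A] [IsNoetherianRing A] [IsIntegrallyClosed A]
  [CommRing S] [IsDomain S] [IsNoetherianRing S] [Algebra A S]
  [FaithfulSMul A S] [Algebra.IsIntegral A S]

variable (A) in
/-- The prime divisor of `Spec A` under a prime divisor of an integral extension. -/
def under (Q : PrimeDivisor S) : PrimeDivisor A where
  asIdeal := Q.asIdeal.under A
  isPrime := inferInstance
  height_eq_one := by
    -- Going down, available since `A` is normal, bounds the height of the contraction by that of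
    -- `Q`; integrality keeps the contraction nonzero.
    have h := Ideal.height_eq_height_add_of_liesOver_of_hasGoingDown (Q.asIdeal.under A) Q.asIdeal
    rw [Q.height_eq_one] at h
    refine le_antisymm (h ▸ le_self_add) (Order.one_le_iff_pos.mpr (pos_iff_ne_zero.mpr ?_))
    rw [Ne, Ideal.height_eq_zero_iff_eq_bot]
    intro h0
    exact Ideal.ne_bot_of_height_eq_one Q.height_eq_one (Ideal.eq_bot_of_comap_eq_bot h0)

omit [IsNoetherianRing A] [IsIntegrallyClosed A] in
-- A prime over `P` exists by lying over; by incomparability a prime strictly below it contracts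
-- strictly below `P`, hence to zero, and so is zero.
theorem exists_lying_over (P : PrimeDivisor A) :
    ∃ Q : PrimeDivisor S, Q.asIdeal.under A = P.asIdeal := by
  obtain ⟨Q, hQ, hQP⟩ := Ideal.exists_ideal_over_prime_of_isIntegral_of_isDomain (S := S) P.asIdeal
    (by rw [(RingHom.injective_iff_ker_eq_bot _).mp (FaithfulSMul.algebraMap_injective A S)]
        exact bot_le)
  refine ⟨⟨Q, hQ, le_antisymm ?_ (Order.one_le_iff_pos.mpr (pos_iff_ne_zero.mpr ?_))⟩,
    hQP⟩
  · have : Q.FiniteHeight := Ideal.finiteHeight_of_isNoetherianRing _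
    refine (Ideal.height_le_iff (p := Q) (n := 1)).mpr fun q hq hlt => ?_
    have h1 : q.under A < P.asIdeal := hQP ▸ Ideal.IsIntegral.comap_lt_comap hlt
    have : P.asIdeal.FiniteHeight := by
      rw [Ideal.finiteHeight_iff, P.height_eq_one]
      simp
    have h2 := Ideal.height_strict_mono_of_isPrime_of_isPrime h1
    rw [P.height_eq_one, Order.lt_one_iff, Ideal.height_eq_zero_iff_eq_bot] at h2
    rw [Ideal.eq_bot_of_comap_eq_bot h2]
    simp
  · rw [Ne, Ideal.height_eq_zero_iff_eq_bot]
    rintro rfl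
    apply Ideal.ne_bot_of_height_eq_one P.height_eq_one
    rw [← hQP]
    exact Ideal.comap_bot_of_injective _ (FaithfulSMul.algebraMap_injective A S)

theorem under_surjective : Function.Surjective (under A : PrimeDivisor S → PrimeDivisor A) := by
  intro P
  obtain ⟨Q, hQ⟩ := exists_lying_over (S := S) P
  exact ⟨Q, PrimeDivisor.ext hQ⟩

/-- The coefficient of a pullback along `Q` is the coefficient of the divisor under `Q` times the
ramification index. -/
theorem pullbackCoeff_eq (D : QDivisor A) (Q : PrimeDivisor S) :
    pullbackCoeff D Q = Q.asIdeal.ramificationIdx A * D (Q.under A) := by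
  classical
  unfold pullbackCoeff
  rw [Finsupp.sum, Finset.sum_eq_single (Q.under A)]
  · exact if_pos rfl
  · intro P _ hP
    rw [if_neg]
    intro h
    exact hP (PrimeDivisor.ext h.symm)
  · intro h
    rw [Finsupp.notMem_support_iff.mp h]
    simp

end Integral

end PrimeDivisor

/-! ### The invariant ring -/

section InvariantRing

variable (k : Type*) [Field k] {n : ℕ} (G : Subgroup (Equiv.Perm (Fin n)))

instance permAction : MulSemiringAction G (MvPolynomial (Fin n) k) where
  smul σ f := MvPolynomial.rename σ.1 f
  one_smul f := MvPolynomial.rename_id_apply f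
  mul_smul σ τ f := (MvPolynomial.rename_rename τ.1 σ.1 f).symm
  smul_zero _ := map_zero _
  smul_add _ := map_add _
  smul_one _ := map_one _
  smul_mul _ := map_mul _

theorem permAction_smul (σ : G) (f : MvPolynomial (Fin n) k) :
    σ • f = MvPolynomial.rename σ.1 f := rfl

/-- Source of integrality and of the separability of the function field extension, even when the
characteristic divides the order of `G`. -/
instance isGaloisGroup_invariantRing :
    IsGaloisGroup G (invariantRing k G) (MvPolynomial (Fin n) k) where
  faithful := ⟨fun {σ τ} h => by
    ext i
    have := h (MvPolynomial.X i)
    rw [permAction_smul, permAction_smul, MvPolynomial.rename_X, MvPolynomial.rename_X] at this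
    exact congrArg _ (MvPolynomial.X_injective this)⟩
  commutes := ⟨fun σ a f => by
    rw [Algebra.smul_def, Algebra.smul_def, smul_mul']
    congr 1
    exact a.2 σ.1 σ.2⟩
  isInvariant := ⟨fun f hf => ⟨⟨f, fun σ hσ => hf ⟨σ, hσ⟩⟩, rfl⟩⟩

instance isIntegral_invariantRing :
    Algebra.IsIntegral (invariantRing k G) (MvPolynomial (Fin n) k) :=
  Algebra.IsInvariant.isIntegral _ _ G

instance finite_invariantRing : Module.Finite (invariantRing k G) (MvPolynomial (Fin n) k) := by
  have : Algebra.FiniteType (invariantRing k G) (MvPolynomial (Fin n) k) :=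
    Algebra.FiniteType.of_restrictScalars_finiteType k _ _
  exact Algebra.IsIntegral.finite

/-- Artin–Tate: the polynomial ring is of finite type over `k` and finite over the invariants, so
the invariants are of finite type. -/
instance isNoetherianRing_invariantRing : IsNoetherianRing (invariantRing k G) := by
  have : Algebra.FiniteType k (invariantRing k G) :=
    ⟨fg_of_fg_of_fg k (invariantRing k G) (MvPolynomial (Fin n) k) Algebra.FiniteType.out
      Module.Finite.fg_top (FaithfulSMul.algebraMap_injective _ _)⟩
  exact Algebra.FiniteType.isNoetherianRing k _

/-- An integral fraction `a / b` of invariants is a polynomial `y` by normality of the polynomial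
ring, and `y * b = a` forces `y` to be invariant. -/
instance isIntegrallyClosed_invariantRing : IsIntegrallyClosed (invariantRing k G) := by
  refine (isIntegrallyClosed_iff (FractionRing (invariantRing k G))).mpr fun {x} hx => ?_
  obtain ⟨a, b, hb, rfl⟩ := IsFractionRing.div_surjective (invariantRing k G) x
  let : Algebra (FractionRing (invariantRing k G)) (FractionRing (MvPolynomial (Fin n) k)) :=
    FractionRing.liftAlgebra _ _
  have := FractionRing.isScalarTower_liftAlgebra (invariantRing k G)
    (FractionRing (MvPolynomial (Fin n) k))
  have hcomp : ∀ s : invariantRing k G, algebraMap (FractionRing (invariantRing k G))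
      (FractionRing (MvPolynomial (Fin n) k)) (algebraMap _ _ s) =
      algebraMap (MvPolynomial (Fin n) k) _ (s : MvPolynomial (Fin n) k) := by
    intro s
    rw [← IsScalarTower.algebraMap_apply]
    rfl
  have hb0 : (b : MvPolynomial (Fin n) k) ≠ 0 := by
    simpa using nonZeroDivisors.ne_zero hb
  have hbK : algebraMap (invariantRing k G) (FractionRing (invariantRing k G)) b ≠ 0 :=
    IsFractionRing.to_map_ne_zero_of_mem_nonZeroDivisors hb
  have hbL : algebraMap (MvPolynomial (Fin n) k) (FractionRing (MvPolynomial (Fin n) k)) b ≠ 0 := by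
    simpa using hb0
  have h0 : IsIntegral (invariantRing k G) (algebraMap (FractionRing (invariantRing k G))
      (FractionRing (MvPolynomial (Fin n) k)) (algebraMap _ _ a / algebraMap _ _ b)) :=
    hx.map (IsScalarTower.toAlgHom (invariantRing k G) (FractionRing (invariantRing k G)) _)
  have h1 := h0.tower_top (A := MvPolynomial (Fin n) k)
  obtain ⟨y, hy⟩ := (IsIntegrallyClosed.isIntegral_iff (R := MvPolynomial (Fin n) k)).mp h1
  rw [map_div₀, hcomp, hcomp, eq_div_iff hbL, ← map_mul] at hy
  have hy' : y * b = a := IsFractionRing.injective _ (FractionRing (MvPolynomial (Fin n) k)) hy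
  refine ⟨⟨y, fun σ hσ => ?_⟩, ?_⟩
  · have h2 := congrArg (MvPolynomial.rename σ) hy'
    rw [map_mul, b.2 σ hσ, a.2 σ hσ, ← hy'] at h2
    exact mul_right_cancel₀ hb0 h2
  · rw [eq_div_iff hbK, ← map_mul]
    exact congrArg _ (Subtype.ext hy')

end InvariantRing


/-! ### Forms of top degree -/

section Multilinear

theorem map_mem_of_forall_mem_span {R ι M N : Type*} [CommRing R] [AddCommGroup M]
    [Module R M] [AddCommGroup N] [Module R N] [Finite ι]
    (f : MultilinearMap R (fun _ : ι => M) N) (X : Set M) (W : Submodule R N)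
    (h : ∀ v : ι → M, (∀ i, v i ∈ X) → f v ∈ W) (v : ι → M)
    (hv : ∀ i, v i ∈ Submodule.span R X) : f v ∈ W := by
  classical
  have := Fintype.ofFinite ι
  suffices H : ∀ (s : Finset ι) (v : ι → M), (∀ i ∈ s, v i ∈ Submodule.span R X) →
      (∀ i ∉ s, v i ∈ X) → f v ∈ W from
    H Finset.univ v (fun i _ => hv i) fun i hi => absurd (Finset.mem_univ i) hi
  intro s
  induction s using Finset.induction_on with
  | empty => exact fun v _ h' => h v fun i => h' i (Finset.notMem_empty i)
  | insert a s ha ih =>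
    intro v h1 h2
    have key : ∀ m ∈ Submodule.span R X, f (Function.update v a m) ∈ W := by
      intro m hm
      induction hm using Submodule.span_induction with
      | mem m hm =>
        refine ih _ (fun i hi => ?_) fun i hi => ?_
        · rw [Function.update_of_ne (fun h : i = a => ha (h ▸ hi))]
          exact h1 i (Finset.mem_insert_of_mem hi)
        · by_cases hia : i = a
          · subst hia
            rwa [Function.update_self]
          · rw [Function.update_of_ne hia]
            exact h2 i fun h => (Finset.mem_insert.mp h).elim hia hi
      | zero => rw [f.map_update_zero]; exact W.zero_mem
      | add x y _ _ hx hy => rw [f.map_update_add]; exact W.add_mem hx hy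
      | smul c x _ hx => rw [f.map_update_smul]; exact W.smul_mem c hx
    simpa using key (v a) (h1 a (Finset.mem_insert_self a s))

end Multilinear

section TopForms

variable {F M : Type*} [Field F] [AddCommGroup M] [Module F M] {n : ℕ}
  (e : Module.Basis (Fin n) F M)

/-- The coordinate of a form of top degree with respect to the wedge product of a basis. -/
def topCoord : ⋀[F]^n M →ₗ[F] F := exteriorPower.alternatingMapLinearEquiv e.det

theorem topCoord_ιMulti (v : Fin n → M) : topCoord e (exteriorPower.ιMulti F n v) = e.det v :=
  exteriorPower.alternatingMapLinearEquiv_apply_ιMulti _ _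

/-- By linearity only wedges of distinct basis vectors matter, and these are signed copies of the
wedge of the basis. -/
theorem topCoord_smul (ω : ⋀[F]^n M) : topCoord e ω • exteriorPower.ιMulti F n e = ω := by
  suffices (LinearMap.toSpanSingleton F _ (exteriorPower.ιMulti F n e)).comp (topCoord e) =
      LinearMap.id from LinearMap.congr_fun this ω
  refine exteriorPower.linearMap_ext (Module.Basis.ext_alternating e fun i h => ?_)
  let σ : Equiv.Perm (Fin n) := Equiv.ofBijective i (Finite.injective_iff_bijective.1 h)
  change topCoord e (exteriorPower.ιMulti F n (e ∘ σ)) • exteriorPower.ιMulti F n e =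
    exteriorPower.ιMulti F n (e ∘ σ)
  rw [topCoord_ιMulti, AlternatingMap.map_perm, AlternatingMap.map_perm, Module.Basis.det_self]
  rcases Int.units_eq_one_or (Equiv.Perm.sign σ) with h | h
  · simp [h]
  · rw [h]
    simp only [Units.neg_smul, one_smul]
    exact neg_one_smul F (exteriorPower.ιMulti F n e)

theorem topCoord_injective : Function.Injective (topCoord e) := fun ω ω' h => by
  rw [← topCoord_smul e ω, h, topCoord_smul]

end TopForms

/-! ### Regular forms at a prime divisor -/

section RegularForms

variable (k : Type*) [Field k] {A : Type*} [CommRing A] [IsDomain A] [Algebra k A]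

/-- The wedge product of the differentials of `n` elements of `A`. -/
def wedgeD {n : ℕ} (a : Fin n → A) : Forms k (FractionRing A) n :=
  exteriorPower.ιMulti (FractionRing A) n fun i =>
    KaehlerDifferential.D k (FractionRing A) (algebraMap A (FractionRing A) (a i))

/-- By the quotient rule `d(b/s)` is a combination of `db` and `ds` over the local ring, so
differentials of elements of `A` suffice. -/
theorem PrimeDivisor.regularForms_eq_span (n : ℕ) (P : PrimeDivisor A) :
    P.regularForms k n = Submodule.span P.localRing (Set.range (wedgeD k (n := n) (A := A))) := by
  apply le_antisymm
  · unfold PrimeDivisor.regularForms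
    rw [Submodule.span_le]
    rintro _ ⟨a, rfl⟩
    refine map_mem_of_forall_mem_span (R := P.localRing)
      ((exteriorPower.ιMulti (FractionRing A) n
        (M := Ω[FractionRing A⁄k])).toMultilinearMap.restrictScalars P.localRing)
      (Set.range fun b : A => KaehlerDifferential.D k (FractionRing A) (algebraMap A _ b))
      _ (fun v hv => ?_) _ fun i => ?_
    · choose b hb using hv
      exact Submodule.subset_span ⟨b, congrArg (exteriorPower.ιMulti (FractionRing A) n)
        (funext hb)⟩
    · obtain ⟨b, s, hs, h⟩ := P.mem_localRing_iff.mp (a i).2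
      have hs0 := P.algebraMap_ne_zero_of_notMem hs
      have hinv : (algebraMap A (FractionRing A) s)⁻¹ ∈ P.localRing :=
        P.mem_localRing_iff.mpr ⟨1, s, hs, by simp⟩
      rw [h, Derivation.leibniz_div, smul_sub, smul_smul, smul_smul]
      have hmem : ∀ c : FractionRing A, c ∈ P.localRing → ∀ x : A,
          c • KaehlerDifferential.D k (FractionRing A) (algebraMap A _ x) ∈
          Submodule.span P.localRing (Set.range fun b : A =>
            KaehlerDifferential.D k (FractionRing A) (algebraMap A _ b)) := fun c hc x =>
        Submodule.smul_mem _ (⟨c, hc⟩ : P.localRing) (Submodule.subset_span ⟨x, rfl⟩)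
      exact Submodule.sub_mem _
        (hmem _ (mul_mem (pow_mem hinv 2) (algebraMap_mem _ s)) _)
        (hmem _ (mul_mem (pow_mem hinv 2) (algebraMap_mem _ b)) _)
  · rw [Submodule.span_le]
    rintro _ ⟨a, rfl⟩
    exact Submodule.subset_span ⟨fun i => algebraMap A P.localRing (a i), rfl⟩

end RegularForms

/-! ### Forms on affine space -/

section AffineSpace

variable (k : Type*) [Field k] (n : ℕ)

/-- The differentials of the coordinates are a basis of the rational one-forms on `𝔸ⁿ`. -/
def coordBasis : Module.Basis (Fin n) (FractionRing (MvPolynomial (Fin n) k))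
    (Ω[FractionRing (MvPolynomial (Fin n) k)⁄k]) :=
  (KaehlerDifferential.mvPolynomialBasis k (Fin n)).ofIsLocalizedModule _
    (nonZeroDivisors (MvPolynomial (Fin n) k))
    (KaehlerDifferential.map k k (MvPolynomial (Fin n) k) (FractionRing (MvPolynomial (Fin n) k)))

/-- The volume form `dx₁ ∧ ⋯ ∧ dxₙ`. -/
def volumeForm : Forms k (FractionRing (MvPolynomial (Fin n) k)) n :=
  exteriorPower.ιMulti _ n (coordBasis k n)

variable {k n}

theorem coordBasis_repr_D (f : MvPolynomial (Fin n) k) (i : Fin n) :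
    (coordBasis k n).repr (KaehlerDifferential.D k _ (algebraMap _ _ f)) i =
      algebraMap _ (FractionRing (MvPolynomial (Fin n) k)) (MvPolynomial.pderiv i f) := by
  have := (KaehlerDifferential.mvPolynomialBasis k (Fin n)).ofIsLocalizedModule_repr_apply
    (FractionRing (MvPolynomial (Fin n) k)) (nonZeroDivisors (MvPolynomial (Fin n) k))
    (KaehlerDifferential.map k k (MvPolynomial (Fin n) k) (FractionRing (MvPolynomial (Fin n) k)))
    (KaehlerDifferential.D k _ f) i
  rw [KaehlerDifferential.mvPolynomialBasis_repr_apply, KaehlerDifferential.map_D] at this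
  exact this

/-- The Jacobian determinant of `n` polynomials in `n` variables. -/
def jacobian (a : Fin n → MvPolynomial (Fin n) k) : MvPolynomial (Fin n) k :=
  (Matrix.of fun i j => MvPolynomial.pderiv j (a i)).det

theorem topCoord_wedgeD (a : Fin n → MvPolynomial (Fin n) k) :
    topCoord (coordBasis k n) (wedgeD k a) = algebraMap _ _ (jacobian a) := by
  rw [wedgeD, topCoord_ιMulti, Module.Basis.det_apply, jacobian, RingHom.map_det,
    ← Matrix.det_transpose]
  congr 1
  ext i j
  simp [Module.Basis.toMatrix_apply, coordBasis_repr_D]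

theorem topCoord_volumeForm : topCoord (coordBasis k n) (volumeForm k n) = 1 := by
  rw [volumeForm, topCoord_ιMulti, Module.Basis.det_self]

theorem volumeForm_eq_wedgeD : volumeForm k n = wedgeD k MvPolynomial.X := by
  apply topCoord_injective (coordBasis k n)
  rw [topCoord_volumeForm, topCoord_wedgeD, jacobian]
  have : (Matrix.of fun i j : Fin n => MvPolynomial.pderiv j (MvPolynomial.X i)) =
      (1 : Matrix (Fin n) (Fin n) (MvPolynomial (Fin n) k)) := by
    ext1 i j
    simp [MvPolynomial.pderiv_X, Matrix.one_apply, Pi.single_apply]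
  rw [this, Matrix.det_one, map_one]

theorem wedgeD_eq_smul_volumeForm (a : Fin n → MvPolynomial (Fin n) k) :
    wedgeD k a = algebraMap _ (FractionRing (MvPolynomial (Fin n) k)) (jacobian a) •
      volumeForm k n := by
  rw [← topCoord_wedgeD, volumeForm, topCoord_smul]

theorem span_volumeForm (Q : PrimeDivisor (MvPolynomial (Fin n) k)) :
    Submodule.span Q.localRing {volumeForm k n} = Q.regularForms k n := by
  rw [PrimeDivisor.regularForms_eq_span]
  apply le_antisymm
  · rw [Submodule.span_singleton_le_iff_mem, volumeForm_eq_wedgeD]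
    exact Submodule.subset_span ⟨_, rfl⟩
  · rw [Submodule.span_le]
    rintro _ ⟨a, rfl⟩
    rw [wedgeD_eq_smul_volumeForm]
    exact Submodule.mem_span_singleton.mpr ⟨algebraMap _ Q.localRing (jacobian a), rfl⟩

end AffineSpace

/-! ### Pullback along a separable extension -/

section Pullback

variable (k : Type*) {K L : Type*} [Field k] [Field K] [Field L] [Algebra k K] [Algebra k L]
  [Algebra K L] [IsScalarTower k K L]

theorem pullbackForm_ιMulti (n : ℕ) (v : Fin n → Ω[K⁄k]) :
    pullbackForm k K L n (exteriorPower.ιMulti K n v) =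
      exteriorPower.ιMulti L n fun i => KaehlerDifferential.map k k K L (v i) :=
  exteriorPower.alternatingMapLinearEquiv_apply_ιMulti _ _

/-- Along a separable algebraic extension, a basis of differentials descends. -/
theorem exists_basis_map_eq_basis [Algebra.IsSeparable K L] {n : ℕ}
    (e : Module.Basis (Fin n) L (Ω[L⁄k])) :
    ∃ (b : Module.Basis (Fin n) K (Ω[K⁄k])) (b' : Module.Basis (Fin n) L (Ω[L⁄k])),
      ∀ i, KaehlerDifferential.map k k K L (b i) = b' i := by
  -- Formal étaleness identifies `L ⊗ Ω[K⁄k]` with `Ω[L⁄k]`; comparison with `e` then shows that a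
  -- basis over `K` has `n` members.
  have : Algebra.FormallyEtale K L := Algebra.FormallyEtale.of_isSeparable K L
  let b₀ := Module.Basis.ofVectorSpace K (Ω[K⁄k])
  let b₁ := (b₀.baseChange L).map (KaehlerDifferential.tensorKaehlerEquivOfFormallyEtale k K L)
  let σ := b₁.indexEquiv e
  refine ⟨b₀.reindex σ, b₁.reindex σ, fun i => ?_⟩
  simp [b₁]

theorem pullbackForm_injective_and_exists_smul_eq [Algebra.IsSeparable K L] {n : ℕ}
    (e : Module.Basis (Fin n) L (Ω[L⁄k])) :
    Function.Injective (pullbackForm k K L n) ∧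
      ∀ η : Forms k K n, η ≠ 0 → ∀ ω : Forms k K n, ∃ c : K, ω = c • η := by
  obtain ⟨b, b', h⟩ := exists_basis_map_eq_basis (K := K) k e
  constructor
  · rw [injective_iff_map_eq_zero]
    intro ω hω
    rw [← topCoord_smul b ω, map_smul, pullbackForm_ιMulti, smul_eq_zero] at hω
    rcases hω with h0 | h0
    · rw [← topCoord_smul b ω, h0, zero_smul]
    · rw [funext h] at h0
      have h1 := topCoord_ιMulti b' b'
      rw [h0, map_zero, Module.Basis.det_self] at h1
      exact absurd h1 zero_ne_one
  · intro η hη ω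
    have h0 : topCoord b η ≠ 0 := fun h0 => hη (topCoord_injective b (by rw [h0, map_zero]))
    refine ⟨topCoord b ω / topCoord b η, topCoord_injective b ?_⟩
    rw [map_smul, smul_eq_mul, div_mul_cancel₀ _ h0]

end Pullback


/-! ### A criterion for a derivation to vanish -/

section Separation

open TensorProduct

variable {R S S' M : Type*} [CommRing R] [CommRing S] [CommRing S'] [Algebra R S] [Algebra R S']
  [AddCommGroup M] [Module R M] [Module S M] [IsScalarTower R S M] (D : Derivation R S M)

/-- The `R`-linear map `y ⊗ z ↦ t(z) • D y`. -/
def twistedDerivation (t : S' →ₐ[R] S) : S ⊗[R] S' →ₗ[R] M :=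
  TensorProduct.lift (LinearMap.mk₂ R (fun y z => t z • D y)
    (fun y y' z => by rw [map_add, smul_add])
    (fun c y z => by rw [Derivation.map_smul, smul_comm])
    (fun y z z' => by rw [map_add, add_smul])
    (fun c y z => by rw [map_smul, smul_assoc]))

/-- The algebra homomorphism `y ⊗ z ↦ y t(z)`. -/
def twistedMul (t : S' →ₐ[R] S) : S ⊗[R] S' →ₐ[R] S :=
  Algebra.TensorProduct.lift (AlgHom.id R S) t fun _ _ => Commute.all _ _

theorem twistedDerivation_tmul (t : S' →ₐ[R] S) (y : S) (z : S') :
    twistedDerivation D t (y ⊗ₜ z) = t z • D y := rfl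

theorem twistedMul_tmul (t : S' →ₐ[R] S) (y : S) (z : S') :
    twistedMul t (y ⊗ₜ[R] z) = y * t z := by
  simp [twistedMul]

/-- A Leibniz rule for the action through `twistedMul t`. In particular it kills any product of two
elements in the kernel of `twistedMul t`. -/
theorem twistedDerivation_mul (t : S' →ₐ[R] S) (E F : S ⊗[R] S') :
    twistedDerivation D t (E * F) =
      twistedMul t E • twistedDerivation D t F + twistedMul t F • twistedDerivation D t E := by
  induction E using TensorProduct.induction_on with
  | zero => simp
  | add E E' h h' =>
    rw [add_mul, map_add, h, h', map_add, map_add, add_smul, smul_add]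
    abel
  | tmul y z =>
    induction F using TensorProduct.induction_on with
    | zero => simp
    | add F F' h h' =>
      rw [mul_add, map_add, h, h', map_add, map_add, add_smul, smul_add]
      abel
    | tmul y' z' =>
      rw [Algebra.TensorProduct.tmul_mul_tmul, twistedDerivation_tmul, twistedDerivation_tmul,
        twistedDerivation_tmul, twistedMul_tmul, twistedMul_tmul, Derivation.leibniz, map_mul,
        smul_add, smul_smul, smul_smul, smul_smul, smul_smul]
      congr 2 <;> ring

/-- Let `T` be a finite set of homomorphisms `S' → S` such that `D` kills all `∑ t(x)`. If the
members of `T` other than `φ` differ from `φ` modulo `Q`, then `D ∘ φ` vanishes at `Q`. -/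
theorem exists_notMem_smul_eq_zero (T : Finset (S' →ₐ[R] S)) (hD : ∀ x, D (∑ t ∈ T, t x) = 0)
    {φ : S' →ₐ[R] S} (hφ : φ ∈ T) (Q : Ideal S) [Q.IsPrime]
    (hsep : ∀ t ∈ T, t ≠ φ → ∃ s, t s - φ s ∉ Q) :
    ∃ u ∉ Q, ∀ x, u • D (φ x) = 0 := by
  classical
  -- On `y ⊗ z` the Leibniz term containing `D (∑ t z)` drops out, so `D` differentiates only the
  -- left factor.
  have hsum : ∀ E : S ⊗[R] S', D (∑ t ∈ T, twistedMul t E) = ∑ t ∈ T, twistedDerivation D t E := by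
    intro E
    induction E using TensorProduct.induction_on with
    | zero => simp
    | add E E' h h' => simp only [map_add, Finset.sum_add_distrib, h, h']
    | tmul y z =>
      simp only [twistedMul_tmul, twistedDerivation_tmul]
      rw [← Finset.mul_sum, Derivation.leibniz, hD, smul_zero, zero_add, Finset.sum_smul]
  have hex : ∀ t : S' →ₐ[R] S, ∃ s, t ∈ T → t ≠ φ → t s - φ s ∉ Q := by
    intro t
    by_cases h : t ∈ T ∧ t ≠ φ
    · obtain ⟨s, hs⟩ := hsep t h.1 h.2
      exact ⟨s, fun _ _ => hs⟩
    · exact ⟨0, fun h1 h2 => absurd ⟨h1, h2⟩ h⟩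
  choose s hs using hex
  -- The factor at `t` dies under `twistedMul t`, while under `φ` it becomes `φ (s t) - t (s t)`,
  -- which is not in `Q`.
  let E : S ⊗[R] S' := ∏ t ∈ T.erase φ, (1 ⊗ₜ s t - t (s t) ⊗ₜ 1)
  have hE : ∀ t ∈ T, t ≠ φ → twistedMul t E = 0 := by
    intro t ht hne
    rw [map_prod]
    refine Finset.prod_eq_zero (Finset.mem_erase.mpr ⟨hne, ht⟩) ?_
    simp [twistedMul_tmul]
  let u := twistedMul φ E
  have hu : u ∉ Q := by
    change twistedMul φ E ∉ Q
    rw [map_prod, Ideal.IsPrime.prod_mem_iff]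
    rintro ⟨t, ht, hmem⟩
    refine hs t (Finset.mem_of_mem_erase ht) (Finset.ne_of_mem_erase ht) ?_
    rw [← neg_mem_iff]
    simpa [twistedMul_tmul] using hmem
  -- With `E * E` in place of `E`, the Leibniz rule also kills the derivative terms at every `t ≠
  -- φ`, leaving only `φ` in the sum.
  have key : ∀ x, D (u * u * φ x) = φ x • twistedDerivation D φ (E * E) := by
    intro x
    have h := hsum (E * E * 1 ⊗ₜ x)
    rw [Finset.sum_eq_single_of_mem φ hφ, Finset.sum_eq_single_of_mem φ hφ] at h
    · rw [twistedDerivation_mul, twistedDerivation_tmul, twistedMul_tmul, one_mul,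
        Derivation.map_one_eq_zero, smul_zero, smul_zero, zero_add] at h
      rw [← h, map_mul (twistedMul φ), map_mul (twistedMul φ), twistedMul_tmul, one_mul]
    · intro t ht hne
      rw [twistedDerivation_mul, twistedDerivation_mul, map_mul, hE t ht hne]
      simp
    · intro t ht hne
      rw [map_mul, map_mul, hE t ht hne]
      simp
  refine ⟨u * u, fun h => hu ((Ideal.IsPrime.mem_or_mem ‹_› h).elim id id), fun x => ?_⟩
  -- The case `x = 1` evaluates `D (u * u)`; subtracting its contribution leaves `(u * u) • D (φ x)
  -- = 0`.
  have h1 := key 1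
  rw [map_one, mul_one, one_smul] at h1
  have h2 := key x
  rw [Derivation.leibniz, h1] at h2
  exact add_eq_right.mp h2

end Separation

/-! ### Jacobians of invariant polynomials -/

section Jacobian

variable {k : Type*} [Field k] {n : ℕ}

/-- The gradient of a polynomial. -/
def grad : Derivation k (MvPolynomial (Fin n) k) (Fin n → MvPolynomial (Fin n) k) :=
  MvPolynomial.mkDerivation k fun i => Pi.single i 1

theorem grad_apply (f : MvPolynomial (Fin n) k) (i : Fin n) :
    grad f i = MvPolynomial.pderiv i f := by
  suffices (LinearMap.proj i).compDer grad = MvPolynomial.pderiv (R := k) i from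
    Derivation.congr_fun this f
  apply MvPolynomial.derivation_ext
  intro j
  simp [grad, Pi.single_apply, MvPolynomial.pderiv_X, eq_comm]

theorem jacobian_eq_detRowAlternating (a : Fin n → MvPolynomial (Fin n) k) :
    jacobian a = Matrix.detRowAlternating fun i => grad (a i) := by
  change Matrix.det _ = Matrix.det _
  congr 1
  ext i j
  simp [grad_apply]

variable (k) (G : Subgroup (Equiv.Perm (Fin n)))

/-- The ideal generated by the Jacobians of invariant polynomials. -/
def jacobianIdeal : Ideal (MvPolynomial (Fin n) k) :=
  Ideal.span (Set.range fun a : Fin n → invariantRing k G => jacobian fun i => (a i).1)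

variable {k G}

/-- The gradient modulo the gradients of invariants kills every sum over the `G`-orbit of `φ`. The
separation criterion then puts a multiple of each row of the Jacobian of `φ` in the span of
invariant gradients, and the determinant is multilinear in the rows. -/
theorem exists_notMem_mul_jacobian_mem
    (φ : MvPolynomial (Fin n) k →ₐ[k] MvPolynomial (Fin n) k)
    (Q : Ideal (MvPolynomial (Fin n) k)) [Q.IsPrime]
    (hsep : ∀ σ ∈ G, (MvPolynomial.rename σ).comp φ ≠ φ →
      ∃ s, MvPolynomial.rename σ (φ s) - φ s ∉ Q) :
    ∃ u ∉ Q, u * jacobian (fun i => φ (MvPolynomial.X i)) ∈ jacobianIdeal k G := by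
  classical
  let N : Submodule (MvPolynomial (Fin n) k) (Fin n → MvPolynomial (Fin n) k) :=
    Submodule.span _ (Set.range fun a : invariantRing k G => grad a.1)
  let D : Derivation k (MvPolynomial (Fin n) k) ((Fin n → MvPolynomial (Fin n) k) ⧸ N) :=
    N.mkQ.compDer grad
  have hD0 : ∀ f, D f = 0 ↔ grad f ∈ N := fun f => Submodule.Quotient.mk_eq_zero N
  -- A set of homomorphisms, not a family indexed by `G`: translates that coincide count once.
  -- Otherwise the stabilizer of `φ` would contribute its order, which can vanish in `k`.
  let T : Finset (MvPolynomial (Fin n) k →ₐ[k] MvPolynomial (Fin n) k) :=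
    Finset.univ.image fun σ : G => (MvPolynomial.rename σ.1).comp φ
  have hT : ∀ σ ∈ G, ∀ t ∈ T, (MvPolynomial.rename σ).comp t ∈ T := by
    intro σ hσ t ht
    obtain ⟨τ, -, rfl⟩ := Finset.mem_image.mp ht
    refine Finset.mem_image.mpr ⟨⟨σ, hσ⟩ * τ, Finset.mem_univ _, ?_⟩
    ext1 i
    simp [MvPolynomial.rename_rename, Equiv.Perm.coe_mul]
  have hcancel : ∀ (σ : Equiv.Perm (Fin n))
      (t : MvPolynomial (Fin n) k →ₐ[k] MvPolynomial (Fin n) k),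
      (MvPolynomial.rename σ).comp ((MvPolynomial.rename ⇑σ⁻¹).comp t) = t := by
    intro σ t
    ext1 i
    simp only [AlgHom.comp_apply, MvPolynomial.rename_rename, ← Equiv.Perm.coe_mul,
      mul_inv_cancel, Equiv.Perm.coe_one, MvPolynomial.rename_id_apply]
  have hD : ∀ x, D (∑ t ∈ T, t x) = 0 := by
    intro x
    rw [hD0]
    refine Submodule.subset_span ⟨⟨∑ t ∈ T, t x, fun σ hσ => ?_⟩, rfl⟩
    rw [map_sum]
    refine Finset.sum_nbij' (fun t => (MvPolynomial.rename σ).comp t)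
      (fun t => (MvPolynomial.rename ⇑σ⁻¹).comp t) (hT σ hσ) (hT σ⁻¹ (inv_mem hσ))
      (fun t _ => ?_) (fun t _ => hcancel σ t) fun t _ => rfl
    simpa using hcancel σ⁻¹ t
  obtain ⟨u, hu, h⟩ := exists_notMem_smul_eq_zero D T hD (φ := φ)
    (Finset.mem_image.mpr ⟨1, Finset.mem_univ _, by ext1 i; simp⟩) Q (by
      intro t ht hne
      obtain ⟨σ, -, rfl⟩ := Finset.mem_image.mp ht
      exact hsep σ.1 σ.2 hne)
  -- One factor `u` for each of the `n` rows.
  refine ⟨u ^ n, fun h' => hu (Ideal.IsPrime.mem_of_pow_mem ‹_› _ h'), ?_⟩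
  have hrow : ∀ i : Fin n, u • grad (φ (MvPolynomial.X i)) ∈ N := fun i =>
    (Submodule.Quotient.mk_eq_zero N).mp (h (MvPolynomial.X i))
  have hmem := map_mem_of_forall_mem_span
    (Matrix.detRowAlternating (R := MvPolynomial (Fin n) k) (n := Fin n)).toMultilinearMap _
    (jacobianIdeal k G) (fun v hv => by
      choose a ha using hv
      refine Ideal.subset_span ⟨a, ?_⟩
      simp only
      rw [jacobian_eq_detRowAlternating]
      exact congrArg _ (funext ha)) _ hrow
  rw [MultilinearMap.map_smul_univ] at hmem
  rw [jacobian_eq_detRowAlternating]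
  simpa using hmem

end Jacobian


/-! ### The hyperplanes fixed by transpositions -/

section Hyperplane

open MvPolynomial

variable {k : Type*} [Field k] {n : ℕ}

theorem rename_sub_rename_mem (Q : Ideal (MvPolynomial (Fin n) k)) {e e' : Fin n → Fin n}
    (h : ∀ l, X (e l) - X (e' l) ∈ Q) (f : MvPolynomial (Fin n) k) :
    rename e f - rename e' f ∈ Q := by
  rw [← Ideal.Quotient.mk_eq_mk_iff_sub_mem]
  suffices (Ideal.Quotient.mkₐ k Q).comp (rename e) = (Ideal.Quotient.mkₐ k Q).comp (rename e') from
    DFunLike.congr_fun this f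
  ext l
  simpa using (Ideal.Quotient.mk_eq_mk_iff_sub_mem _ _).mpr (h l)

/-- Substituting `x_j` for `x_i` changes `f` only by a multiple of `x_i - x_j`. Primality and
membership questions are thereby reduced to a substitution. -/
theorem mem_span_X_sub_X_iff {i j : Fin n} {f : MvPolynomial (Fin n) k} :
    f ∈ Ideal.span {(X i - X j : MvPolynomial (Fin n) k)} ↔
      rename (Function.update id i j) f = 0 := by
  constructor
  · intro h
    obtain ⟨g, rfl⟩ := Ideal.mem_span_singleton'.mp h
    simp only [map_mul, map_sub, rename_X, Function.update_self]
    by_cases hij : j = i <;> simp [hij]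
  · intro h
    have := rename_sub_rename_mem (Ideal.span {(X i - X j : MvPolynomial (Fin n) k)})
      (e := id) (e' := Function.update id i j) (fun l => ?_) f
    · rwa [h, sub_zero, rename_id_apply] at this
    · by_cases hl : l = i
      · subst hl
        simp
      · simp [Function.update_of_ne hl]

theorem X_sub_X_ne_zero {i j : Fin n} (hij : i ≠ j) : (X i - X j : MvPolynomial (Fin n) k) ≠ 0 :=
  sub_ne_zero.mpr fun h => hij (X_injective h)

theorem prime_X_sub_X {i j : Fin n} (hij : i ≠ j) :
    Prime (X i - X j : MvPolynomial (Fin n) k) := by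
  rw [← Ideal.span_singleton_prime (X_sub_X_ne_zero hij)]
  have : Ideal.span {(X i - X j : MvPolynomial (Fin n) k)} =
      RingHom.ker (rename (R := k) (Function.update id i j)) := by
    ext f
    rw [mem_span_X_sub_X_iff]
    rfl
  rw [this]
  exact RingHom.ker_isPrime _

theorem X_sub_X_mem_iff {i j a b : Fin n} (hab : a ≠ b) :
    (X a - X b : MvPolynomial (Fin n) k) ∈ Ideal.span {(X i - X j : MvPolynomial (Fin n) k)} ↔
      (a = i ∧ b = j) ∨ (a = j ∧ b = i) := by
  rw [mem_span_X_sub_X_iff, map_sub, rename_X, rename_X, sub_eq_zero, X_injective.eq_iff]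
  by_cases ha : a = i
  · subst ha
    rw [Function.update_self, Function.update_of_ne hab.symm, id]
    constructor
    · rintro rfl
      exact Or.inl ⟨rfl, rfl⟩
    · rintro (⟨-, rfl⟩ | ⟨rfl, rfl⟩) <;> simp_all
  · rw [Function.update_of_ne ha, id]
    by_cases hb : b = i
    · subst hb
      rw [Function.update_self]
      simp [ha]
    · rw [Function.update_of_ne hb, id]
      simp [ha, hb, hab]

theorem PrimeDivisor.asIdeal_eq_span_X_sub_X (Q : PrimeDivisor (MvPolynomial (Fin n) k))
    {i j : Fin n} (hij : i ≠ j) (h : X i - X j ∈ Q.asIdeal) :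
    Q.asIdeal = Ideal.span {(X i - X j : MvPolynomial (Fin n) k)} :=
  Ideal.eq_span_singleton_of_height_eq_one Q.height_eq_one h (prime_X_sub_X hij)

/-- A nontrivial permutation which acts trivially on a divisor is a transposition, and the divisor
is its mirror. -/
theorem exists_eq_swap_of_forall_mem (Q : PrimeDivisor (MvPolynomial (Fin n) k))
    {σ : Equiv.Perm (Fin n)} (hσ : σ ≠ 1)
    (h : ∀ l, (X (σ l) - X l : MvPolynomial (Fin n) k) ∈ Q.asIdeal) :
    ∃ i j, i ≠ j ∧ σ = Equiv.swap i j ∧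
      Q.asIdeal = Ideal.span {(X i - X j : MvPolynomial (Fin n) k)} := by
  obtain ⟨i, hi⟩ : ∃ i, σ i ≠ i := by
    by_contra! hall
    exact hσ (Equiv.ext hall)
  -- One moved index already determines `Q`; any other moved index yields a difference of variables
  -- in the same ideal, hence the same pair.
  have hQ := Q.asIdeal_eq_span_X_sub_X hi (h i)
  have hall : ∀ l, σ l ≠ l → (σ l = σ i ∧ l = i) ∨ (σ l = i ∧ l = σ i) := fun l hl =>
    (X_sub_X_mem_iff hl).mp (hQ ▸ h l)
  refine ⟨σ i, i, hi, ?_, hQ⟩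
  ext1 l
  by_cases hl : σ l = l
  · rw [hl, Equiv.swap_apply_of_ne_of_ne]
    · rintro rfl
      exact hi (σ.injective hl)
    · rintro rfl
      exact hi hl
  · rcases hall l hl with ⟨-, rfl⟩ | ⟨h1, rfl⟩
    · simp
    · rw [h1, Equiv.swap_apply_left]

/-- `Q` is the mirror of a transposition in `G`. -/
def IsMirror (G : Subgroup (Equiv.Perm (Fin n))) (Q : PrimeDivisor (MvPolynomial (Fin n) k)) : Prop :=
  ∃ i j, i ≠ j ∧ Equiv.swap i j ∈ G ∧
    Q.asIdeal = Ideal.span {(X i - X j : MvPolynomial (Fin n) k)}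

variable {G : Subgroup (Equiv.Perm (Fin n))}

/-- Off the mirrors no nontrivial element of `G` acts trivially modulo `Q`, so the identity is
separated from its translates; its Jacobian is `1`. -/
theorem exists_jacobian_notMem_of_not_isMirror {Q : PrimeDivisor (MvPolynomial (Fin n) k)}
    (hQ : ¬ IsMirror G Q) :
    ∃ a : Fin n → invariantRing k G, jacobian (fun i => (a i).1) ∉ Q.asIdeal := by
  obtain ⟨u, hu, h⟩ := exists_notMem_mul_jacobian_mem (G := G) (AlgHom.id k _) Q.asIdeal (by
    intro σ hσ hne
    by_contra! hall
    have h1 : σ ≠ 1 := by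
      rintro rfl
      refine hne ?_
      ext1 i
      simp
    obtain ⟨i, j, hij, rfl, hij'⟩ := exists_eq_swap_of_forall_mem Q h1 fun l => by
      simpa using hall (X l)
    exact hQ ⟨i, j, hij, hσ, hij'⟩)
  have hj : jacobian (fun i : Fin n => (AlgHom.id k (MvPolynomial (Fin n) k)) (X i)) = 1 := by
    rw [jacobian, ← Matrix.det_one (n := Fin n)]
    congr 1
    ext1 i j
    simp [pderiv_X, Matrix.one_apply, Pi.single_apply]
  rw [hj, mul_one] at h
  by_contra! hall
  refine hu (Ideal.span_le.mpr ?_ h)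
  rintro _ ⟨a, rfl⟩
  exact hall a

/-- The transposition exchanges the partial derivatives of an invariant in `x_i` and `x_j` and acts
trivially on the mirror, so two columns agree there. -/
theorem jacobian_mem_of_isMirror {i j : Fin n} (hij : i ≠ j) (hG : Equiv.swap i j ∈ G)
    (a : Fin n → invariantRing k G) :
    jacobian (fun i => (a i).1) ∈ Ideal.span {(X i - X j : MvPolynomial (Fin n) k)} := by
  set Q := Ideal.span {(X i - X j : MvPolynomial (Fin n) k)} with hQ
  rw [← Ideal.Quotient.eq_zero_iff_mem, jacobian, RingHom.map_det]
  refine Matrix.det_zero_of_column_eq hij fun l => ?_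
  change Ideal.Quotient.mk Q (pderiv i (a l).1) = Ideal.Quotient.mk Q (pderiv j (a l).1)
  have h1 := pderiv_rename (R := k) (Equiv.swap i j).injective j (a l).1
  rw [(a l).2 _ hG, Equiv.swap_apply_right] at h1
  rw [h1, Ideal.Quotient.mk_eq_mk_iff_sub_mem]
  have h2 := rename_sub_rename_mem Q (e := Equiv.swap i j) (e' := id) (fun m => ?_)
    (pderiv j (a l).1)
  · rwa [rename_id_apply] at h2
  · have h0 := Ideal.mem_span_singleton_self (X i - X j : MvPolynomial (Fin n) k)
    by_cases hmi : m = i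
    · subst hmi
      rw [Equiv.swap_apply_left, ← neg_mem_iff, neg_sub]
      exact h0
    · by_cases hmj : m = j
      · subst hmj
        rw [Equiv.swap_apply_right]
        exact h0
      · rw [Equiv.swap_apply_of_ne_of_ne hmi hmj, id, sub_self]
        exact Q.zero_mem

/-- The quotient of `𝔸ⁿ` by the transposition of `i` and `j`: the elementary symmetric functions of
the two coordinates and the other coordinates. -/
def foldMap (k : Type*) [Field k] {n : ℕ} (i j : Fin n) :
    MvPolynomial (Fin n) k →ₐ[k] MvPolynomial (Fin n) k :=
  aeval (Function.update (Function.update X i (X i + X j)) j (X i * X j))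

theorem foldMap_X_left {i j : Fin n} (hij : i ≠ j) : foldMap k i j (X i) = X i + X j := by
  simp [foldMap, Function.update_of_ne hij]

theorem foldMap_X_right {i j : Fin n} : foldMap k i j (X j) = X i * X j := by
  simp [foldMap]

theorem foldMap_X_of_ne {i j l : Fin n} (hi : l ≠ i) (hj : l ≠ j) : foldMap k i j (X l) = X l := by
  simp [foldMap, Function.update_of_ne hi, Function.update_of_ne hj]

theorem jacobian_foldMap {i j : Fin n} (hij : i ≠ j) :
    jacobian (fun l => foldMap k i j (X l)) = X i - X j := by
  rw [jacobian_eq_detRowAlternating]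
  let e : Fin n → Fin n → MvPolynomial (Fin n) k := fun l => Pi.single l 1
  have he : Matrix.detRowAlternating e = 1 := by
    change Matrix.det (Matrix.of e) = 1
    rw [← Matrix.det_one (n := Fin n)]
    congr 1
    ext1 a b
    simp [e, Matrix.one_apply, Pi.single_apply, eq_comm]
  have hgX : ∀ l, grad (k := k) (X l) = e l := fun l => by simp [grad, e]
  -- The gradient of `x_i x_j` is split as `x_j` times row `i` plus `(x_i - x_j) e_j`: the first
  -- part repeats a row, the second leaves a determinant equal to `1`.
  have hrow : (fun l => grad (foldMap k i j (X l))) =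
      Function.update (Function.update e i (e i + e j)) j
        ((X j : MvPolynomial (Fin n) k) • (e i + e j) +
          (X i - X j : MvPolynomial (Fin n) k) • e j) := by
    funext l
    by_cases hlj : l = j
    · subst hlj
      rw [foldMap_X_right, Function.update_self, Derivation.leibniz, hgX, hgX]
      module
    · rw [Function.update_of_ne hlj]
      by_cases hli : l = i
      · subst hli
        rw [foldMap_X_left hij, Function.update_self, map_add, hgX, hgX]
      · rw [foldMap_X_of_ne hli hlj, Function.update_of_ne hli, hgX]
  rw [hrow, AlternatingMap.map_update_add, AlternatingMap.map_update_smul,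
    AlternatingMap.map_update_smul]
  have h1 : Matrix.detRowAlternating
      (Function.update (Function.update e i (e i + e j)) j (e i + e j)) = 0 := by
    refine AlternatingMap.map_eq_zero_of_eq _ _ (i := i) (j := j) ?_ hij
    rw [Function.update_of_ne hij, Function.update_self, Function.update_self]
  have h2 : Matrix.detRowAlternating
      (Function.update (Function.update e i (e i + e j)) j (e j)) = 1 := by
    have : Function.update (Function.update e i (e i + e j)) j (e j) =
        Function.update e i (e i + e j) := by
      rw [Function.update_eq_self_iff, Function.update_of_ne hij.symm]
    rw [this, AlternatingMap.map_update_add, Function.update_eq_self, he,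
      AlternatingMap.map_update_self _ _ hij, add_zero]
  rw [h1, h2, smul_zero, zero_add, smul_eq_mul, mul_one]

/-- A `σ` fixing the fold map modulo `Q` acts trivially modulo `Q`, so it is the identity or the
transposition of `i` and `j`; both fix the fold map exactly. -/
theorem rename_comp_foldMap_separates (Q : PrimeDivisor (MvPolynomial (Fin n) k)) {i j : Fin n}
    (hij : i ≠ j) (hQ : Q.asIdeal = Ideal.span {(X i - X j : MvPolynomial (Fin n) k)})
    (σ : Equiv.Perm (Fin n)) (hne : (rename σ).comp (foldMap k i j) ≠ foldMap k i j) :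
    ∃ s, rename σ (foldMap k i j s) - foldMap k i j s ∉ Q.asIdeal := by
  by_contra! hall
  -- Modulo `Q`, `x_{σ i}` is a root of `(T - x_i)(T - x_j)`, and `x_j ≡ x_i`.
  have hsq : (X (σ i) - X i : MvPolynomial (Fin n) k) ^ 2 ∈ Q.asIdeal := by
    have h1 := hall (X i)
    have h2 := hall (X j)
    have h0 : (X i - X j : MvPolynomial (Fin n) k) ∈ Q.asIdeal :=
      hQ ▸ Ideal.mem_span_singleton_self _
    rw [foldMap_X_left hij, map_add, rename_X, rename_X] at h1
    rw [foldMap_X_right, map_mul, rename_X, rename_X] at h2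
    have : (X (σ i) - X i : MvPolynomial (Fin n) k) ^ 2 =
        X (σ i) * (X (σ i) + X (σ j) - (X i + X j)) - (X (σ i) * X (σ j) - X i * X j) +
          (X i - X (σ i)) * (X i - X j) := by ring
    rw [this]
    exact add_mem (sub_mem (Ideal.mul_mem_left _ _ h1) h2) (Ideal.mul_mem_left _ _ h0)
  have hi : (X (σ i) - X i : MvPolynomial (Fin n) k) ∈ Q.asIdeal :=
    Q.isPrime.mem_of_pow_mem _ hsq
  have htriv : ∀ l, (X (σ l) - X l : MvPolynomial (Fin n) k) ∈ Q.asIdeal := by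
    intro l
    by_cases hli : l = i
    · exact hli ▸ hi
    by_cases hlj : l = j
    · subst hlj
      have h1 := hall (X i)
      rw [foldMap_X_left hij, map_add, rename_X, rename_X] at h1
      have : (X (σ l) - X l : MvPolynomial (Fin n) k) =
          X (σ i) + X (σ l) - (X i + X l) - (X (σ i) - X i) := by ring
      rw [this]
      exact sub_mem h1 hi
    · simpa [foldMap_X_of_ne hli hlj] using hall (X l)
  have hσ : σ ≠ 1 := by
    rintro rfl
    refine hne ?_
    ext1 l
    simp
  obtain ⟨a, b, hab, rfl, hQ'⟩ := exists_eq_swap_of_forall_mem Q hσ htriv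
  have hmem : (X a - X b : MvPolynomial (Fin n) k) ∈
      Ideal.span {(X i - X j : MvPolynomial (Fin n) k)} := by
    rw [← hQ, hQ']
    exact Ideal.mem_span_singleton_self _
  have hswap : Equiv.swap a b = Equiv.swap i j := by
    rcases (X_sub_X_mem_iff hab).mp hmem with ⟨rfl, rfl⟩ | ⟨rfl, rfl⟩
    · rfl
    · exact Equiv.swap_comm _ _
  rw [hswap] at hne
  refine hne ?_
  ext1 l
  rw [AlgHom.comp_apply]
  by_cases hlj : l = j
  · subst hlj
    rw [foldMap_X_right, map_mul, rename_X, rename_X, Equiv.swap_apply_left,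
      Equiv.swap_apply_right, mul_comm]
  · by_cases hli : l = i
    · subst hli
      rw [foldMap_X_left hij, map_add, rename_X, rename_X, Equiv.swap_apply_left,
        Equiv.swap_apply_right, add_comm]
    · rw [foldMap_X_of_ne hli hlj, rename_X, Equiv.swap_apply_of_ne_of_ne hli hlj]

/-- Some `u * (x_i - x_j)` with `u` outside `Q` lies in the Jacobian ideal; if every Jacobian were
divisible by `(x_i - x_j)²`, then `u` would lie in `Q`. -/
theorem exists_jacobian_eq_of_isMirror (Q : PrimeDivisor (MvPolynomial (Fin n) k)) {i j : Fin n}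
    (hij : i ≠ j) (hG : Equiv.swap i j ∈ G)
    (hQ : Q.asIdeal = Ideal.span {(X i - X j : MvPolynomial (Fin n) k)}) :
    ∃ (a : Fin n → invariantRing k G) (c : MvPolynomial (Fin n) k), c ∉ Q.asIdeal ∧
      jacobian (fun i => (a i).1) = (X i - X j) * c := by
  obtain ⟨u, hu, h⟩ := exists_notMem_mul_jacobian_mem (G := G) (foldMap k i j) Q.asIdeal
    fun σ _ hne => rename_comp_foldMap_separates Q hij hQ σ hne
  rw [jacobian_foldMap hij] at h
  have hdvd : ∀ a : Fin n → invariantRing k G, ∃ c,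
      jacobian (fun i => (a i).1) = (X i - X j) * c := fun a =>
    Ideal.mem_span_singleton.mp (jacobian_mem_of_isMirror hij hG a)
  choose c hc using hdvd
  by_contra! hall
  have hle : jacobianIdeal k G ≤
      Ideal.span {((X i - X j) * (X i - X j) : MvPolynomial (Fin n) k)} := by
    rw [jacobianIdeal, Ideal.span_le]
    rintro _ ⟨a, rfl⟩
    have hca : c a ∈ Q.asIdeal := by
      by_contra hn
      exact hall a (c a) hn (hc a)
    rw [hQ] at hca
    simp only [SetLike.mem_coe, hc a]
    exact Ideal.mem_span_singleton.mpr (mul_dvd_mul_left _ (Ideal.mem_span_singleton.mp hca))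
  obtain ⟨d, hd⟩ := Ideal.mem_span_singleton.mp (hle h)
  refine hu ?_
  rw [hQ]
  refine Ideal.mem_span_singleton.mpr ⟨d, mul_right_cancel₀ (X_sub_X_ne_zero hij) ?_⟩
  rw [hd]
  ring

end Hyperplane


/-! ### Finiteness of zeros and poles -/

section Finiteness

variable {A : Type*} [CommRing A] [IsDomain A] [IsNoetherianRing A]

/-- Such primes are minimal over `(a)`, since only zero lies strictly below a prime of height one in
a domain. -/
theorem finite_setOf_mem_asIdeal {a : A} (ha : a ≠ 0) :
    {P : PrimeDivisor A | a ∈ P.asIdeal}.Finite := by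
  have hinj : Function.Injective (PrimeDivisor.asIdeal : PrimeDivisor A → Ideal A) :=
    fun _ _ => PrimeDivisor.ext
  refine Set.Finite.of_finite_image (f := PrimeDivisor.asIdeal)
    (Set.Finite.subset (Ideal.span {a}).finite_minimalPrimes_of_isNoetherianRing ?_)
    hinj.injOn
  rintro _ ⟨P, hP, rfl⟩
  refine ⟨⟨P.isPrime, (Ideal.span_singleton_le_iff_mem _).mpr hP⟩, fun I hI hle => ?_⟩
  have := hI.1
  by_contra hn
  have hlt : I < P.asIdeal := lt_of_le_not_ge hle hn
  have hfin : P.asIdeal.FiniteHeight := Ideal.finiteHeight_of_isNoetherianRing _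
  have h := Ideal.height_strict_mono_of_isPrime_of_isPrime hlt
  rw [P.height_eq_one, Order.lt_one_iff, Ideal.height_eq_zero_iff_eq_bot] at h
  rw [h] at hI
  exact ha ((Ideal.mem_bot).mp ((Ideal.span_singleton_le_iff_mem _).mp hI.2))

theorem finite_setOf_ord_ne_zero [IsIntegrallyClosed A] {f : FractionRing A} (hf : f ≠ 0) :
    {P : PrimeDivisor A | P.ord f ≠ 0}.Finite := by
  obtain ⟨a, b, hb, rfl⟩ := IsFractionRing.div_surjective A f
  have hb0 := nonZeroDivisors.ne_zero hb
  have ha0 : a ≠ 0 := by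
    rintro rfl
    simp at hf
  refine Set.Finite.subset ((finite_setOf_mem_asIdeal ha0).union (finite_setOf_mem_asIdeal hb0))
    fun P hP => ?_
  by_contra hn
  rw [Set.mem_union, not_or] at hn
  apply hP
  rw [P.ord_div (P.algebraMap_ne_zero_of_notMem hn.1) (P.algebraMap_ne_zero_of_notMem hn.2),
    P.ord_eq_zero_of_notMem hn.1, P.ord_eq_zero_of_notMem hn.2, sub_zero]

theorem PrimeDivisor.ord_prod [IsIntegrallyClosed A] (P : PrimeDivisor A) {ι : Type*}
    (T : Finset ι) (f : ι → A) (hf : ∀ i ∈ T, f i ≠ 0) :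
    P.ord (algebraMap A (FractionRing A) (∏ i ∈ T, f i)) =
      ∑ i ∈ T, P.ord (algebraMap A (FractionRing A) (f i)) := by
  classical
  induction T using Finset.induction_on with
  | empty => simp [P.ord_one]
  | insert i T hi ih =>
    rw [Finset.prod_insert hi, Finset.sum_insert hi, map_mul, P.ord_mul, ih]
    · exact fun j hj => hf j (Finset.mem_insert_of_mem hj)
    · simpa using hf i (Finset.mem_insert_self i T)
    · rw [Ne, FaithfulSMul.algebraMap_eq_zero_iff, Finset.prod_eq_zero_iff]
      rintro ⟨j, hj, h0⟩
      exact hf j (Finset.mem_insert_of_mem hj) h0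

end Finiteness

/-! ### Divisors of forms and their pullbacks -/

section DivisorOfForm

variable (k : Type*) [Field k] {A : Type*} [CommRing A] [IsDomain A] [Algebra k A]
  [IsNoetherianRing A] [IsIntegrallyClosed A]

/-- Two generators differ by a unit of the local ring, which has order zero. -/
theorem IsDivisorOfForm.eq_ord {n : ℕ} {ω : Forms k (FractionRing A) n} {D : WeilDivisor A}
    (h : IsDivisorOfForm k n ω D) (hω : ω ≠ 0) {P : PrimeDivisor A}
    {η : Forms k (FractionRing A) n} {f : FractionRing A}
    (hη : Submodule.span P.localRing {η} = P.regularForms k n) (hf : ω = f • η) :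
    D P = P.ord f := by
  obtain ⟨η', f', hη', hf', hord⟩ := h P
  rw [← hord]
  obtain ⟨u, hu⟩ := Submodule.mem_span_singleton.mp
    (hη.symm ▸ hη' ▸ Submodule.mem_span_singleton_self η')
  obtain ⟨v, hv⟩ := Submodule.mem_span_singleton.mp
    (hη'.symm ▸ hη ▸ Submodule.mem_span_singleton_self η)
  change (u : FractionRing A) • η = η' at hu
  change (v : FractionRing A) • η' = η at hv
  have hη0 : η ≠ 0 := by
    rintro rfl
    exact hω (by rw [hf, smul_zero])
  have hf0 : f ≠ 0 := by
    rintro rfl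
    exact hω (by rw [hf, zero_smul])
  have hf0' : f' ≠ 0 := by
    rintro rfl
    exact hω (by rw [hf', zero_smul])
  have h1 : (v * u : FractionRing A) = 1 := by
    rw [← hu, smul_smul] at hv
    exact smul_left_injective _ hη0 (by simpa using hv)
  have h2 : f' * u = f := by
    rw [← hu, smul_smul, hf] at hf'
    exact (smul_left_injective _ hη0 hf').symm
  have hu0 : (u : FractionRing A) ≠ 0 := right_ne_zero_of_mul_eq_one h1
  have hv0 : (v : FractionRing A) ≠ 0 := left_ne_zero_of_mul_eq_one h1
  have h3 := P.ord_mul hv0 hu0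
  rw [h1, P.ord_one] at h3
  have h4 := P.ord_nonneg hu0 u.2
  have h5 := P.ord_nonneg hv0 v.2
  rw [← h2, P.ord_mul hf0' hu0]
  omega

end DivisorOfForm

section RationalPullback

/-- The inclusion of function fields induced by an injective homomorphism of domains. -/
def fracMap (A S : Type*) [CommRing A] [IsDomain A] [CommRing S] [IsDomain S] [Algebra A S]
    [FaithfulSMul A S] : FractionRing A →+* FractionRing S :=
  letI : Algebra (FractionRing A) (FractionRing S) := FractionRing.liftAlgebra A (FractionRing S)
  algebraMap (FractionRing A) (FractionRing S)

variable (k : Type*) {A : Type*} (S : Type*) [Field k] [CommRing A] [IsDomain A]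
  [CommRing S] [IsDomain S] [Algebra k A] [Algebra k S] [Algebra A S] [IsScalarTower k A S]
  [FaithfulSMul A S]

omit [Algebra k A] [Algebra k S] [IsScalarTower k A S] in
theorem fracMap_algebraMap (a : A) :
    fracMap A S (algebraMap A _ a) = algebraMap S _ (algebraMap A S a) := by
  let : Algebra (FractionRing A) (FractionRing S) := FractionRing.liftAlgebra A (FractionRing S)
  have : IsScalarTower A (FractionRing A) (FractionRing S) :=
    FractionRing.isScalarTower_liftAlgebra A (FractionRing S)
  change algebraMap (FractionRing A) (FractionRing S) (algebraMap A _ a) = _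
  rw [← IsScalarTower.algebraMap_apply, ← IsScalarTower.algebraMap_apply]

variable {S} in
omit [Algebra k A] [Algebra k S] [IsScalarTower k A S] in
theorem fracMap_ne_zero {f : FractionRing A} (hf : f ≠ 0) : fracMap A S f ≠ 0 :=
  (map_ne_zero _).mpr hf

variable {S} in
omit [Algebra k A] [Algebra k S] [IsScalarTower k A S] in
theorem ord_fracMap [IsNoetherianRing A] [IsIntegrallyClosed A] [IsNoetherianRing S]
    [IsIntegrallyClosed S] [Algebra.IsIntegral A S] (Q : PrimeDivisor S) {f : FractionRing A}
    (hf : f ≠ 0) :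
    Q.ord (fracMap A S f) = Q.asIdeal.ramificationIdx A * (Q.under A).ord f := by
  let : Algebra (FractionRing A) (FractionRing S) := FractionRing.liftAlgebra A (FractionRing S)
  have : IsScalarTower A (FractionRing A) (FractionRing S) :=
    FractionRing.isScalarTower_liftAlgebra A (FractionRing S)
  exact PrimeDivisor.ord_algebraMap_eq (P := Q.under A) rfl hf

theorem pullbackRationalForm_smul (n : ℕ) (c : FractionRing A)
    (ω : Forms k (FractionRing A) n) :
    pullbackRationalForm k S n (c • ω) = fracMap A S c • pullbackRationalForm k S n ω := by
  let : Algebra (FractionRing A) (FractionRing S) := FractionRing.liftAlgebra A (FractionRing S)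
  have : IsScalarTower A (FractionRing A) (FractionRing S) :=
    FractionRing.isScalarTower_liftAlgebra A (FractionRing S)
  unfold pullbackRationalForm
  rw [map_smul]
  exact (algebraMap_smul (FractionRing S) c _).symm

theorem pullbackRationalForm_wedgeD {n : ℕ} (a : Fin n → A) :
    pullbackRationalForm k S n (wedgeD k a) = wedgeD k fun i => algebraMap A S (a i) := by
  let : Algebra (FractionRing A) (FractionRing S) := FractionRing.liftAlgebra A (FractionRing S)
  have : IsScalarTower A (FractionRing A) (FractionRing S) :=
    FractionRing.isScalarTower_liftAlgebra A (FractionRing S)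
  unfold pullbackRationalForm wedgeD
  rw [pullbackForm_ιMulti]
  congr 1
  funext i
  rw [KaehlerDifferential.map_D, ← fracMap_algebraMap]
  rfl

theorem pullbackRationalForm_injective_and_exists_smul_eq (G : Type*) [Group G] [Finite G]
    [MulSemiringAction G S] [IsGaloisGroup G A S] {n : ℕ}
    (e : Module.Basis (Fin n) (FractionRing S) (Ω[FractionRing S⁄k])) :
    (∀ ω : Forms k (FractionRing A) n, pullbackRationalForm k S n ω = 0 → ω = 0) ∧
    ∀ η : Forms k (FractionRing A) n, η ≠ 0 → ∀ ω : Forms k (FractionRing A) n,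
      ∃ c : FractionRing A, ω = c • η := by
  let : Algebra (FractionRing A) (FractionRing S) := FractionRing.liftAlgebra A (FractionRing S)
  have : IsScalarTower A (FractionRing A) (FractionRing S) :=
    FractionRing.isScalarTower_liftAlgebra A (FractionRing S)
  have : IsScalarTower k (FractionRing A) (FractionRing S) :=
    IsScalarTower.of_algebraMap_eq fun c => by
      rw [IsScalarTower.algebraMap_apply k A (FractionRing A),
        ← IsScalarTower.algebraMap_apply A (FractionRing A) (FractionRing S),
        ← IsScalarTower.algebraMap_apply k A (FractionRing S)]
  let := IsFractionRing.mulSemiringAction G S (FractionRing S)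
  have : IsGalois (FractionRing A) (FractionRing S) := IsGaloisGroup.isGalois G _ _
  have h := pullbackForm_injective_and_exists_smul_eq (K := FractionRing A) k e
  refine ⟨fun ω hω => h.1 ?_, h.2⟩
  rw [map_zero]
  exact hω

theorem span_wedgeD_eq_regularForms [IsNoetherianRing A] [IsIntegrallyClosed A] {n : ℕ}
    (P : PrimeDivisor A) (a : Fin n → A)
    (h : ∀ b : Fin n → A, ∃ c : FractionRing A, wedgeD k b = c • wedgeD k a ∧
      (c ≠ 0 → 0 ≤ P.ord c)) :
    Submodule.span P.localRing {wedgeD k a} = P.regularForms k n := by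
  rw [PrimeDivisor.regularForms_eq_span]
  apply le_antisymm
  · rw [Submodule.span_singleton_le_iff_mem]
    exact Submodule.subset_span ⟨a, rfl⟩
  · rw [Submodule.span_le]
    rintro _ ⟨b, rfl⟩
    obtain ⟨c, hc, hord⟩ := h b
    have hmem : c ∈ P.localRing := by
      by_cases hc0 : c = 0
      · exact hc0 ▸ zero_mem _
      · exact P.mem_localRing_of_ord_nonneg (hord hc0)
    rw [hc]
    exact Submodule.mem_span_singleton.mpr ⟨⟨c, hmem⟩, rfl⟩

variable {k S} in
theorem wedgeD_ne_zero {n : ℕ} {a : Fin n → A}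
    (h : wedgeD k (fun i => algebraMap A S (a i)) ≠ 0) : wedgeD k a ≠ 0 := by
  intro h0
  apply h
  rw [← pullbackRationalForm_wedgeD, h0, ← zero_smul (FractionRing A) (wedgeD k a),
    pullbackRationalForm_smul, map_zero, zero_smul]

variable {k} in
theorem wedgeD_algebraMap_eq_smul {n : ℕ} {a b : Fin n → A} {c : FractionRing A}
    (h : wedgeD k b = c • wedgeD k a) :
    wedgeD k (fun i => algebraMap A S (b i)) =
      fracMap A S c • wedgeD k (fun i => algebraMap A S (a i)) := by
  rw [← pullbackRationalForm_wedgeD, ← pullbackRationalForm_wedgeD, h, pullbackRationalForm_smul]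

end RationalPullback

/-! ### The canonical divisor of the quotient -/

section Canonical

variable {k : Type*} [Field k] {n : ℕ} {G : Subgroup (Equiv.Perm (Fin n))}

open scoped Classical in
/-- The multiplicity of the ramification divisor of `𝔸ⁿ → 𝔸ⁿ / G` along `Q`. -/
def mirrorMult (G : Subgroup (Equiv.Perm (Fin n))) (Q : PrimeDivisor (MvPolynomial (Fin n) k)) :
    ℤ := if IsMirror G Q then 1 else 0

theorem mirrorMult_of_isMirror {Q : PrimeDivisor (MvPolynomial (Fin n) k)} (h : IsMirror G Q) :
    mirrorMult G Q = 1 := if_pos h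

theorem mirrorMult_of_not_isMirror {Q : PrimeDivisor (MvPolynomial (Fin n) k)}
    (h : ¬ IsMirror G Q) : mirrorMult G Q = 0 := if_neg h

theorem ord_X_sub_X_eq_one {Q : PrimeDivisor (MvPolynomial (Fin n) k)} {i j : Fin n}
    (hQ : Q.asIdeal = Ideal.span {(MvPolynomial.X i - MvPolynomial.X j : MvPolynomial (Fin n) k)}) :
    Q.ord (algebraMap _ _ (MvPolynomial.X i - MvPolynomial.X j : MvPolynomial (Fin n) k)) = 1 :=
  (Q.isUniformizer_of_asIdeal_eq_span hQ).ord_eq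

theorem ord_jacobian_ge (Q : PrimeDivisor (MvPolynomial (Fin n) k)) (a : Fin n → invariantRing k G)
    (ha : jacobian (fun i => (a i).1) ≠ 0) :
    mirrorMult G Q ≤ Q.ord (algebraMap _ _ (jacobian fun i => (a i).1)) := by
  by_cases h : IsMirror G Q
  · rw [mirrorMult_of_isMirror h]
    obtain ⟨i, j, hij, hG, hQ⟩ := h
    exact Q.ord_pos_of_mem ha (hQ ▸ jacobian_mem_of_isMirror hij hG a)
  · rw [mirrorMult_of_not_isMirror h]
    exact Q.ord_nonneg (by simpa using ha) (algebraMap_mem _ _)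

theorem exists_ord_jacobian_eq (G : Subgroup (Equiv.Perm (Fin n)))
    (Q : PrimeDivisor (MvPolynomial (Fin n) k)) :
    ∃ a : Fin n → invariantRing k G, jacobian (fun i => (a i).1) ≠ 0 ∧
      Q.ord (algebraMap _ _ (jacobian fun i => (a i).1)) = mirrorMult G Q := by
  by_cases h : IsMirror G Q
  · rw [mirrorMult_of_isMirror h]
    obtain ⟨i, j, hij, hG, hQ⟩ := h
    obtain ⟨a, c, hc, hac⟩ := exists_jacobian_eq_of_isMirror Q hij hG hQ
    have hc0 := Q.algebraMap_ne_zero_of_notMem hc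
    have hd0 := X_sub_X_ne_zero (k := k) hij
    refine ⟨a, ?_, ?_⟩
    · rw [hac]
      exact mul_ne_zero hd0 (by simpa using hc0)
    · rw [hac, map_mul, Q.ord_mul (IsFractionRing.to_map_ne_zero_of_mem_nonZeroDivisors
      (mem_nonZeroDivisors_of_ne_zero hd0)) hc0, Q.ord_eq_zero_of_notMem hc,
        ord_X_sub_X_eq_one hQ, add_zero]
  · rw [mirrorMult_of_not_isMirror h]
    obtain ⟨a, ha⟩ := exists_jacobian_notMem_of_not_isMirror h
    refine ⟨a, ?_, Q.ord_eq_zero_of_notMem ha⟩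
    intro h0
    exact ha (h0 ▸ zero_mem _)

theorem ramificationIdx_pos (G : Subgroup (Equiv.Perm (Fin n)))
    (Q : PrimeDivisor (MvPolynomial (Fin n) k)) :
    0 < (Q.asIdeal.ramificationIdx (invariantRing k G) : ℤ) :=
  Nat.cast_pos.mpr (Ideal.ramificationIdx_pos _ _)

theorem topCoord_pullback_wedgeD (a : Fin n → invariantRing k G) :
    topCoord (coordBasis k n) (pullbackRationalForm k (MvPolynomial (Fin n) k) n (wedgeD k a)) =
      algebraMap _ _ (jacobian fun i => (a i).1) := by
  rw [pullbackRationalForm_wedgeD, topCoord_wedgeD]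
  rfl

/-- Under every prime divisor `Q` of `𝔸ⁿ` the regular forms on `𝔸ⁿ / G` have a generator, and the
pullback of this generator vanishes along `Q` to order `mirrorMult G Q`. -/
theorem exists_generator_regularForms (G : Subgroup (Equiv.Perm (Fin n)))
    (Q : PrimeDivisor (MvPolynomial (Fin n) k)) :
    ∃ η : Forms k (FractionRing (invariantRing k G)) n, η ≠ 0 ∧
      Submodule.span (Q.under (invariantRing k G)).localRing {η} =
        (Q.under (invariantRing k G)).regularForms k n ∧
      topCoord (coordBasis k n) (pullbackRationalForm k (MvPolynomial (Fin n) k) n η) ≠ 0 ∧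
      Q.ord (topCoord (coordBasis k n)
        (pullbackRationalForm k (MvPolynomial (Fin n) k) n η)) = mirrorMult G Q := by
  -- A Jacobian of least order gives the generator: for `wedgeD k b = c • wedgeD k a`, the
  -- ramification index times the order of `c` is a difference of Jacobian orders, hence
  -- nonnegative.
  obtain ⟨a, ha0, ha⟩ := exists_ord_jacobian_eq G Q
  have hJ : algebraMap _ (FractionRing (MvPolynomial (Fin n) k))
    (jacobian fun i => (a i).1) ≠ 0 := by simpa using ha0
  have hJ' : wedgeD k (fun i => algebraMap (invariantRing k G) (MvPolynomial (Fin n) k) (a i)) ≠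
      0 := by
    intro h0
    have h := topCoord_pullback_wedgeD a
    rw [pullbackRationalForm_wedgeD, h0, map_zero] at h
    exact hJ h.symm
  have hη := wedgeD_ne_zero hJ'
  refine ⟨wedgeD k a, hη, span_wedgeD_eq_regularForms k _ a fun b => ?_, ?_, ?_⟩
  · obtain ⟨c, hc⟩ := (pullbackRationalForm_injective_and_exists_smul_eq k (MvPolynomial (Fin n) k)
      G (coordBasis k n)).2 _ hη (wedgeD k b)
    refine ⟨c, hc, fun hc0 => ?_⟩
    have hc0' : fracMap (invariantRing k G) (MvPolynomial (Fin n) k) c ≠ 0 :=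
      fracMap_ne_zero hc0
    have hb : algebraMap _ (FractionRing (MvPolynomial (Fin n) k))
        (jacobian fun i => (b i).1) = fracMap (invariantRing k G) (MvPolynomial (Fin n) k) c *
          algebraMap _ _ (jacobian fun i => (a i).1) := by
      have := congrArg (topCoord (coordBasis k n))
        (wedgeD_algebraMap_eq_smul (MvPolynomial (Fin n) k) hc)
      rw [map_smul, topCoord_wedgeD, topCoord_wedgeD] at this
      exact this
    have hb0 : jacobian (fun i => (b i).1) ≠ 0 := by
      intro h0
      rw [h0, map_zero] at hb
      exact mul_ne_zero hc0' hJ hb.symm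
    have h1 := ord_jacobian_ge Q b hb0
    rw [hb, Q.ord_mul hc0' hJ, ha, ord_fracMap Q hc0, le_add_iff_nonneg_left] at h1
    exact nonneg_of_mul_nonneg_right h1 (ramificationIdx_pos G Q)
  · rwa [topCoord_pullback_wedgeD]
  · rwa [topCoord_pullback_wedgeD]

end Canonical


/-! ### The discriminant of the transpositions in `G` -/

section Discriminant

open MvPolynomial

variable (k : Type*) [Field k] {n : ℕ} (G : Subgroup (Equiv.Perm (Fin n)))

open scoped Classical in
/-- The ordered pairs of distinct indices whose transposition lies in `G`. -/
def mirrorPairs : Finset (Fin n × Fin n) :=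
  Finset.univ.filter fun x => x.1 ≠ x.2 ∧ Equiv.swap x.1 x.2 ∈ G

/-- The ordered pairs of increasing indices whose transposition lies in `G`. -/
def increasingMirrorPairs : Finset (Fin n × Fin n) :=
  (mirrorPairs G).filter fun x => x.1 < x.2

variable {G}

theorem mem_mirrorPairs {x : Fin n × Fin n} :
    x ∈ mirrorPairs G ↔ x.1 ≠ x.2 ∧ Equiv.swap x.1 x.2 ∈ G := by
  simp [mirrorPairs]

variable (G) in
/-- The discriminant: up to sign, the square of the product of the equations of all mirrors. -/
def discriminant : invariantRing k G :=
  ⟨∏ x ∈ mirrorPairs G, (X x.1 - X x.2), fun σ hσ => by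
    have hmem : ∀ τ ∈ G, ∀ x ∈ mirrorPairs G, (τ x.1, τ x.2) ∈ mirrorPairs G := by
      intro τ hτ x hx
      rw [mem_mirrorPairs] at hx ⊢
      refine ⟨τ.injective.ne hx.1, ?_⟩
      rw [Equiv.swap_apply_apply]
      exact mul_mem (mul_mem hτ hx.2) (inv_mem hτ)
    rw [map_prod]
    exact Finset.prod_nbij' (fun x => (σ x.1, σ x.2)) (fun x => (σ⁻¹ x.1, σ⁻¹ x.2)) (hmem σ hσ)
      (hmem σ⁻¹ (inv_mem hσ)) (fun x _ => by simp) (fun x _ => by simp) fun x _ => by simp⟩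

variable {k}

theorem ord_X_sub_X_eq {Q : PrimeDivisor (MvPolynomial (Fin n) k)} {i j a b : Fin n}
    (hQ : Q.asIdeal = Ideal.span {(X i - X j : MvPolynomial (Fin n) k)}) (hab : a ≠ b) :
    Q.ord (algebraMap _ _ (X a - X b : MvPolynomial (Fin n) k)) =
      if (a, b) = (i, j) ∨ (a, b) = (j, i) then 1 else 0 := by
  have hiff := X_sub_X_mem_iff (k := k) (i := i) (j := j) hab
  simp only [Prod.mk.injEq]
  split_ifs with h
  · refine ord_X_sub_X_eq_one (Q.asIdeal_eq_span_X_sub_X hab ?_)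
    rw [hQ]
    exact hiff.mpr h
  · refine Q.ord_eq_zero_of_notMem fun hmem => h (hiff.mp ?_)
    rwa [hQ] at hmem

theorem ord_prod_mirrorPairs_of_not_isMirror {Q : PrimeDivisor (MvPolynomial (Fin n) k)}
    (h : ¬ IsMirror G Q) {T : Finset (Fin n × Fin n)} (hT : T ⊆ mirrorPairs G) :
    Q.ord (algebraMap _ _ (∏ x ∈ T, (X x.1 - X x.2 : MvPolynomial (Fin n) k))) = 0 := by
  refine Q.ord_eq_zero_of_notMem ?_
  rw [Ideal.IsPrime.prod_mem_iff]
  rintro ⟨x, hx, hmem⟩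
  obtain ⟨h1, h2⟩ := mem_mirrorPairs.mp (hT hx)
  exact h ⟨x.1, x.2, h1, h2, Q.asIdeal_eq_span_X_sub_X h1 hmem⟩

theorem ord_prod_mirrorPairs {Q : PrimeDivisor (MvPolynomial (Fin n) k)} {i j : Fin n}
    (hQ : Q.asIdeal = Ideal.span {(X i - X j : MvPolynomial (Fin n) k)})
    {T : Finset (Fin n × Fin n)} (hT : T ⊆ mirrorPairs G) :
    Q.ord (algebraMap _ _ (∏ x ∈ T, (X x.1 - X x.2 : MvPolynomial (Fin n) k))) =
      (T.filter fun x => x = (i, j) ∨ x = (j, i)).card := by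
  have hne : ∀ x ∈ T, x.1 ≠ x.2 := fun x hx => (mem_mirrorPairs.mp (hT hx)).1
  refine (Q.ord_prod _ _ fun x hx => X_sub_X_ne_zero (hne x hx)).trans ?_
  refine (Finset.sum_congr rfl fun x hx => ord_X_sub_X_eq hQ (hne x hx)).trans ?_
  exact Finset.sum_boole _ _

/-- A mirror is cut out by exactly two of the factors, those of `(i, j)` and `(j, i)`. -/
theorem ord_discriminant (Q : PrimeDivisor (MvPolynomial (Fin n) k)) :
    Q.ord (algebraMap _ _ (discriminant k G).1) = 2 * mirrorMult G Q := by
  by_cases h : IsMirror G Q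
  · rw [mirrorMult_of_isMirror h]
    obtain ⟨i, j, hij, hG, hQ⟩ := h
    refine (ord_prod_mirrorPairs hQ subset_rfl).trans ?_
    have : ((mirrorPairs G).filter fun x => x = (i, j) ∨ x = (j, i)) = {(i, j), (j, i)} := by
      ext x
      simp only [Finset.mem_filter, mem_mirrorPairs, Finset.mem_insert, Finset.mem_singleton,
        and_iff_right_iff_imp]
      rintro (rfl | rfl)
      · exact ⟨hij, hG⟩
      · exact ⟨hij.symm, Equiv.swap_comm i j ▸ hG⟩
    rw [this, Finset.card_pair]
    · norm_num
    · simp [hij]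
  · rw [mirrorMult_of_not_isMirror h]
    exact ord_prod_mirrorPairs_of_not_isMirror h subset_rfl

theorem discriminant_ne_zero : discriminant k G ≠ 0 := by
  intro h
  have h1 : (discriminant k G).1 = 0 := by rw [h]; rfl
  obtain ⟨x, hx, h0⟩ := Finset.prod_eq_zero_iff.mp h1
  exact X_sub_X_ne_zero (mem_mirrorPairs.mp hx).1 h0

section CharTwo

variable [CharP k 2]

theorem sq_prod_increasingMirrorPairs :
    (∏ x ∈ increasingMirrorPairs G, (X x.1 - X x.2 : MvPolynomial (Fin n) k)) ^ 2 =
      (discriminant k G).1 := by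
  change _ = ∏ x ∈ mirrorPairs G, (X x.1 - X x.2 : MvPolynomial (Fin n) k)
  rw [← Finset.prod_filter_mul_prod_filter_not (mirrorPairs G) (fun x => x.1 < x.2), sq]
  congr 1
  refine Finset.prod_nbij' Prod.swap Prod.swap ?_ ?_ (fun _ _ => rfl) (fun _ _ => rfl)
    fun x _ => ?_
  · intro x hx
    rw [increasingMirrorPairs, Finset.mem_filter, mem_mirrorPairs] at hx
    rw [Finset.mem_filter, mem_mirrorPairs]
    exact ⟨⟨hx.1.1.symm, Equiv.swap_comm x.1 x.2 ▸ hx.1.2⟩, hx.2.not_gt⟩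
  · intro x hx
    rw [Finset.mem_filter, mem_mirrorPairs] at hx
    rw [increasingMirrorPairs, Finset.mem_filter, mem_mirrorPairs]
    exact ⟨⟨hx.1.1.symm, Equiv.swap_comm x.1 x.2 ▸ hx.1.2⟩,
      lt_of_le_of_ne (not_lt.mp hx.2) hx.1.1.symm⟩
  · rw [← CharTwo.neg_eq (X x.1 - X x.2 : MvPolynomial (Fin n) k), neg_sub]
    rfl

variable (k G) in
/-- In characteristic two, the product of the equations of all mirrors is invariant. -/
def mirrorProduct : invariantRing k G :=
  ⟨∏ x ∈ increasingMirrorPairs G, (X x.1 - X x.2), fun σ hσ => by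
    have h := (discriminant k G).2 σ hσ
    rw [← sq_prod_increasingMirrorPairs, map_pow] at h
    exact CharTwo.sq_injective h⟩

theorem mirrorProduct_ne_zero : mirrorProduct k G ≠ 0 := by
  intro h0
  have h1 : (mirrorProduct k G).1 = 0 := by rw [h0]; rfl
  have h2 := sq_prod_increasingMirrorPairs (k := k) (G := G)
  change (mirrorProduct k G).1 ^ 2 = _ at h2
  rw [h1, zero_pow two_ne_zero] at h2
  exact discriminant_ne_zero (Subtype.ext h2.symm)

theorem ord_mirrorProduct (Q : PrimeDivisor (MvPolynomial (Fin n) k)) :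
    Q.ord (algebraMap _ _ (mirrorProduct k G).1) = mirrorMult G Q := by
  have h0 : algebraMap _ (FractionRing (MvPolynomial (Fin n) k)) (mirrorProduct k G).1 ≠ 0 :=
    IsFractionRing.to_map_ne_zero_of_mem_nonZeroDivisors (mem_nonZeroDivisors_of_ne_zero
      fun h => mirrorProduct_ne_zero (Subtype.ext h))
  have h := ord_discriminant (G := G) Q
  rw [← sq_prod_increasingMirrorPairs, map_pow] at h
  have h2 := Q.ord_pow h0 2
  change Q.ord ((algebraMap _ (FractionRing (MvPolynomial (Fin n) k)) (mirrorProduct k G).1) ^ 2)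
    = _ at h
  rw [h2] at h
  push_cast at h
  linarith

end CharTwo

end Discriminant

/-! ### The boundary divisor -/

section Boundary

variable {k : Type*} [Field k] {n : ℕ} {G : Subgroup (Equiv.Perm (Fin n))}

theorem ramificationIdx_mul_ord (Q : PrimeDivisor (MvPolynomial (Fin n) k))
    {f : invariantRing k G} (hf : f ≠ 0) :
    (Q.asIdeal.ramificationIdx (invariantRing k G) : ℤ) *
      (Q.under (invariantRing k G)).ord (algebraMap _ _ f) = Q.ord (algebraMap _ _ f.1) := by
  have hf' : algebraMap _ (FractionRing (invariantRing k G)) f ≠ 0 :=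
    IsFractionRing.to_map_ne_zero_of_mem_nonZeroDivisors (mem_nonZeroDivisors_of_ne_zero hf)
  rw [← ord_fracMap Q hf', fracMap_algebraMap]
  rfl

theorem topCoord_ne_zero {ω : Forms k (FractionRing (invariantRing k G)) n} (hω : ω ≠ 0) :
    topCoord (coordBasis k n) (pullbackRationalForm k (MvPolynomial (Fin n) k) n ω) ≠ 0 := by
  intro h0
  refine hω ((pullbackRationalForm_injective_and_exists_smul_eq k (MvPolynomial (Fin n) k)
    G (coordBasis k n)).1 ω (topCoord_injective (coordBasis k n) ?_))
  rw [h0, map_zero]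

/-- The Hurwitz formula: the order along `Q` of the pullback of a form, in terms of the order of the
form along the image of `Q`. -/
theorem exists_generator_and_ord_eq {ω : Forms k (FractionRing (invariantRing k G)) n} (hω : ω ≠ 0)
    (Q : PrimeDivisor (MvPolynomial (Fin n) k)) :
    ∃ (η : Forms k (FractionRing (invariantRing k G)) n) (f : FractionRing (invariantRing k G)),
      Submodule.span (Q.under (invariantRing k G)).localRing {η} =
        (Q.under (invariantRing k G)).regularForms k n ∧ ω = f • η ∧
      (Q.asIdeal.ramificationIdx (invariantRing k G) : ℤ) *
        (Q.under (invariantRing k G)).ord f + mirrorMult G Q =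
      Q.ord (topCoord (coordBasis k n)
        (pullbackRationalForm k (MvPolynomial (Fin n) k) n ω)) := by
  obtain ⟨η, hη, hspan, hne, hord⟩ := exists_generator_regularForms G Q
  obtain ⟨f, hf⟩ := (pullbackRationalForm_injective_and_exists_smul_eq k (MvPolynomial (Fin n) k)
    G (coordBasis k n)).2 η hη ω
  have hf0 : f ≠ 0 := by
    rintro rfl
    exact hω (by rw [hf, zero_smul])
  refine ⟨η, f, hspan, hf, ?_⟩
  rw [hf, pullbackRationalForm_smul, map_smul, smul_eq_mul, Q.ord_mul (fracMap_ne_zero hf0) hne,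
    hord, ord_fracMap Q hf0]

theorem IsDivisorOfForm.ord_topCoord_eq {ω : Forms k (FractionRing (MvPolynomial (Fin n) k)) n}
    (hω : ω ≠ 0) {D : WeilDivisor (MvPolynomial (Fin n) k)} (h : IsDivisorOfForm k n ω D)
    (Q : PrimeDivisor (MvPolynomial (Fin n) k)) : D Q = Q.ord (topCoord (coordBasis k n) ω) :=
  h.eq_ord k hω (span_volumeForm Q) (topCoord_smul (coordBasis k n) ω).symm

theorem finite_setOf_isMirror :
    {Q : PrimeDivisor (MvPolynomial (Fin n) k) | IsMirror G Q}.Finite := by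
  have h0 : (discriminant k G).1 ≠ 0 := fun h => discriminant_ne_zero (Subtype.ext h)
  refine Set.Finite.subset (finite_setOf_mem_asIdeal h0) fun Q hQ => ?_
  by_contra hn
  have h1 := Q.ord_eq_zero_of_notMem hn
  rw [ord_discriminant, mirrorMult_of_isMirror hQ] at h1
  norm_num at h1

theorem exists_isDivisorOfForm {ω : Forms k (FractionRing (invariantRing k G)) n} (hω : ω ≠ 0) :
    ∃ KX : WeilDivisor (invariantRing k G), IsDivisorOfForm k n ω KX := by
  have hex : ∀ P : PrimeDivisor (invariantRing k G), ∃ m : ℤ,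
      (∃ (η : Forms k (FractionRing (invariantRing k G)) n) (f : FractionRing (invariantRing k G)),
        Submodule.span P.localRing {η} = P.regularForms k n ∧ ω = f • η ∧ P.ord f = m) ∧
      (m ≠ 0 → P ∈ PrimeDivisor.under (invariantRing k G) ''
        ({Q : PrimeDivisor (MvPolynomial (Fin n) k) | Q.ord (topCoord (coordBasis k n)
          (pullbackRationalForm k (MvPolynomial (Fin n) k) n ω)) ≠ 0} ∪
          {Q | IsMirror G Q})) := by
    intro P
    obtain ⟨Q, rfl⟩ := PrimeDivisor.under_surjective (S := MvPolynomial (Fin n) k) P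
    obtain ⟨η, f, hspan, hf, hord⟩ := exists_generator_and_ord_eq hω Q
    refine ⟨_, ⟨η, f, hspan, hf, rfl⟩, fun hm => ⟨Q, ?_, rfl⟩⟩
    by_contra hn
    rw [Set.mem_union, not_or] at hn
    have h1 : Q.ord (topCoord (coordBasis k n)
      (pullbackRationalForm k (MvPolynomial (Fin n) k) n ω)) = 0 := not_not.mp hn.1
    rw [h1, mirrorMult_of_not_isMirror hn.2, add_zero] at hord
    exact (mul_ne_zero (ramificationIdx_pos G Q).ne' hm) hord
  choose m h1 h2 using hex
  refine ⟨Finsupp.ofSupportFinite m (Set.Finite.subset (Set.Finite.image _ (Set.Finite.union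
    (finite_setOf_ord_ne_zero (topCoord_ne_zero hω)) finite_setOf_isMirror))
    fun P hP => h2 P hP), fun P => ?_⟩
  exact h1 P

theorem exists_isDivisorOfForm_affineSpace
    {ω : Forms k (FractionRing (MvPolynomial (Fin n) k)) n}
    (hω : topCoord (coordBasis k n) ω ≠ 0) :
    ∃ KV : WeilDivisor (MvPolynomial (Fin n) k), IsDivisorOfForm k n ω KV :=
  ⟨Finsupp.ofSupportFinite (fun Q => Q.ord (topCoord (coordBasis k n) ω))
    (finite_setOf_ord_ne_zero hω), fun Q => ⟨volumeForm k n, _, span_volumeForm Q,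
      (topCoord_smul (coordBasis k n) ω).symm, rfl⟩⟩

theorem isCrepantBoundary_iff (B : QDivisor (invariantRing k G)) :
    IsCrepantBoundary k G B ↔ ∀ Q : PrimeDivisor (MvPolynomial (Fin n) k),
      (Q.asIdeal.ramificationIdx (invariantRing k G) : ℚ) * B (Q.under (invariantRing k G)) =
        mirrorMult G Q := by
  have key : ∀ {ω : Forms k (FractionRing (invariantRing k G)) n} (_ : ω ≠ 0)
      {KX : WeilDivisor (invariantRing k G)} {KV : WeilDivisor (MvPolynomial (Fin n) k)}
      (_ : IsDivisorOfForm k n ω KX)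
      (_ : IsDivisorOfForm k n (pullbackRationalForm k (MvPolynomial (Fin n) k) n ω) KV)
      (Q : PrimeDivisor (MvPolynomial (Fin n) k)),
      pullbackCoeff (KX.toQ + B) Q = (KV Q : ℚ) ↔
        (Q.asIdeal.ramificationIdx (invariantRing k G) : ℚ) * B (Q.under (invariantRing k G)) =
          mirrorMult G Q := by
    intro ω hω KX KV hKX hKV Q
    obtain ⟨η, f, hspan, hf, hord⟩ := exists_generator_and_ord_eq hω Q
    have hne : pullbackRationalForm k (MvPolynomial (Fin n) k) n ω ≠ 0 := fun h0 =>
      topCoord_ne_zero hω (by rw [h0, map_zero])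
    rw [← hKX.eq_ord k hω hspan hf, ← hKV.ord_topCoord_eq hne] at hord
    rw [PrimeDivisor.pullbackCoeff_eq, ← hord]
    have : (KX.toQ + B) (Q.under (invariantRing k G)) =
        (KX (Q.under (invariantRing k G)) : ℚ) + B (Q.under (invariantRing k G)) := rfl
    rw [this]
    push_cast
    rw [mul_add, add_right_inj]
  constructor
  · intro h Q
    obtain ⟨η, hη, -⟩ := exists_generator_regularForms G Q
    obtain ⟨KX, KV, hKX, hKV, h'⟩ := h η hη
    exact (key hη hKX hKV Q).mp (h' Q)
  · intro h ω hω
    obtain ⟨KX, hKX⟩ := exists_isDivisorOfForm hω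
    obtain ⟨KV, hKV⟩ := exists_isDivisorOfForm_affineSpace (topCoord_ne_zero hω)
    exact ⟨KX, KV, hKX, hKV, fun Q => (key hω hKX hKV Q).mpr (h Q)⟩

theorem two_mul_eq_ord_discriminant {B : QDivisor (invariantRing k G)}
    (h : IsCrepantBoundary k G B) (P : PrimeDivisor (invariantRing k G)) :
    2 * B P = P.ord (algebraMap _ _ (discriminant k G)) := by
  obtain ⟨Q, rfl⟩ := PrimeDivisor.under_surjective (S := MvPolynomial (Fin n) k) P
  have h1 := (isCrepantBoundary_iff B).mp h Q
  have h2 := ramificationIdx_mul_ord Q (discriminant_ne_zero (k := k) (G := G))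
  rw [ord_discriminant] at h2
  have he : (Q.asIdeal.ramificationIdx (invariantRing k G) : ℚ) ≠ 0 := by
    exact_mod_cast (ramificationIdx_pos G Q).ne'
  have h3 : (Q.asIdeal.ramificationIdx (invariantRing k G) : ℚ) *
      ((Q.under (invariantRing k G)).ord (algebraMap _ _ (discriminant k G)) : ℚ) =
      2 * (mirrorMult G Q : ℚ) := by exact_mod_cast h2
  apply mul_left_cancel₀ he
  rw [h3, ← h1]
  ring

theorem eq_ord_mirrorProduct [CharP k 2] {B : QDivisor (invariantRing k G)}
    (h : IsCrepantBoundary k G B) (P : PrimeDivisor (invariantRing k G)) :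
    B P = P.ord (algebraMap _ _ (mirrorProduct k G)) := by
  obtain ⟨Q, rfl⟩ := PrimeDivisor.under_surjective (S := MvPolynomial (Fin n) k) P
  have h1 := (isCrepantBoundary_iff B).mp h Q
  have h2 := ramificationIdx_mul_ord Q (mirrorProduct_ne_zero (k := k) (G := G))
  rw [ord_mirrorProduct] at h2
  have he : (Q.asIdeal.ramificationIdx (invariantRing k G) : ℚ) ≠ 0 := by
    exact_mod_cast (ramificationIdx_pos G Q).ne'
  apply mul_left_cancel₀ he
  rw [h1]
  exact_mod_cast h2.symm

variable (k G) in
theorem existsUnique_isBoundary :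
    ∃! B : QDivisor (invariantRing k G), IsBoundary k G B := by
  let B₀ : QDivisor (invariantRing k G) := Finsupp.ofSupportFinite
    (fun P => (P.ord (algebraMap _ _ (discriminant k G)) : ℚ) / 2) (by
      refine Set.Finite.subset (finite_setOf_ord_ne_zero
        (IsFractionRing.to_map_ne_zero_of_mem_nonZeroDivisors
          (mem_nonZeroDivisors_of_ne_zero (discriminant_ne_zero (k := k) (G := G))))) ?_
      intro P hP h0
      exact hP (by simp only [h0, Int.cast_zero, zero_div]))
  have hB₀ : ∀ P, B₀ P = (P.ord (algebraMap _ _ (discriminant k G)) : ℚ) / 2 := fun P => rfl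
  refine ⟨B₀, ⟨fun P => ?_, (isCrepantBoundary_iff B₀).mpr fun Q => ?_⟩, fun B hB => ?_⟩
  · rw [hB₀]
    refine div_nonneg (Int.cast_nonneg (P.ord_nonneg ?_ (algebraMap_mem _ _))) zero_le_two
    exact IsFractionRing.to_map_ne_zero_of_mem_nonZeroDivisors
      (mem_nonZeroDivisors_of_ne_zero discriminant_ne_zero)
  · have h2 := ramificationIdx_mul_ord Q (discriminant_ne_zero (k := k) (G := G))
    rw [ord_discriminant] at h2
    have h3 : (Q.asIdeal.ramificationIdx (invariantRing k G) : ℚ) *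
        ((Q.under (invariantRing k G)).ord (algebraMap _ _ (discriminant k G)) : ℚ) =
        2 * (mirrorMult G Q : ℚ) := by exact_mod_cast h2
    rw [hB₀]
    linarith
  · ext P
    have := two_mul_eq_ord_discriminant hB.2 P
    rw [hB₀, ← this]
    ring

end Boundary


/-! ### The multiplicities of the boundary -/

section Multiplicity

open MvPolynomial

variable {k : Type*} [Field k] {n : ℕ} {G : Subgroup (Equiv.Perm (Fin n))}

theorem mem_of_invariant_eq_mul (h2 : (2 : k) ≠ 0) {Q : PrimeDivisor (MvPolynomial (Fin n) k)}
    {i j : Fin n} (hij : i ≠ j) (hG : Equiv.swap i j ∈ G)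
    (hQ : Q.asIdeal = Ideal.span {(X i - X j : MvPolynomial (Fin n) k)})
    {t : invariantRing k G} {w : MvPolynomial (Fin n) k} (ht : t.1 = (X i - X j) * w) :
    w ∈ Q.asIdeal := by
  have h1 := t.2 _ hG
  rw [ht, map_mul, map_sub, rename_X, rename_X, Equiv.swap_apply_left,
    Equiv.swap_apply_right] at h1
  have h3 : rename (Equiv.swap i j) w = -w := by
    apply mul_left_cancel₀ (X_sub_X_ne_zero (k := k) hij.symm)
    rw [h1]
    ring
  have h4 := rename_sub_rename_mem Q.asIdeal (e := Equiv.swap i j) (e' := id) (fun m => ?_) w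
  · rw [rename_id_apply, h3] at h4
    have h5 : w = C (-(2 : k)⁻¹) * (-w - w) := by
      have : (C (2 : k)⁻¹ * 2 : MvPolynomial (Fin n) k) = 1 := by
        rw [show (2 : MvPolynomial (Fin n) k) = C 2 from (map_ofNat C 2).symm, ← C_mul,
          inv_mul_cancel₀ h2, C_1]
      rw [C_neg]
      linear_combination (-w) * this
    rw [h5]
    exact Ideal.mul_mem_left _ _ h4
  · have h0 : (X i - X j : MvPolynomial (Fin n) k) ∈ Q.asIdeal :=
      hQ ▸ Ideal.mem_span_singleton_self _
    by_cases hmi : m = i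
    · subst hmi
      rw [Equiv.swap_apply_left, ← neg_mem_iff, neg_sub]
      exact h0
    · by_cases hmj : m = j
      · subst hmj
        rw [Equiv.swap_apply_right]
        exact h0
      · rw [Equiv.swap_apply_of_ne_of_ne hmi hmj, id, sub_self]
        exact zero_mem _

theorem IsMirror.ramificationIdx_ne_one (h2 : (2 : k) ≠ 0)
    {Q : PrimeDivisor (MvPolynomial (Fin n) k)} (h : IsMirror G Q) :
    Q.asIdeal.ramificationIdx (invariantRing k G) ≠ 1 := by
  intro h1
  obtain ⟨i, j, hij, hG, hQ⟩ := h
  obtain ⟨t, ht⟩ := (Q.under (invariantRing k G)).exists_isUniformizer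
  have he := ht.ramificationIdx_eq (Q := Q) rfl
  rw [h1, Nat.cast_one] at he
  have htQ : t.1 ∈ Q.asIdeal := by
    by_contra hn
    have h0 := Q.ord_eq_zero_of_notMem hn
    exact one_ne_zero (he.trans h0)
  obtain ⟨w, hw⟩ := Ideal.mem_span_singleton.mp (hQ ▸ htQ)
  have hwQ := mem_of_invariant_eq_mul h2 hij hG hQ hw
  have ht0 : t.1 ≠ 0 := by
    intro h0
    have h0' : t = 0 := Subtype.ext h0
    exact ht.ne_zero (by rw [h0', map_zero])
  have hw0 : w ≠ 0 := by
    rintro rfl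
    exact ht0 (by rw [hw, mul_zero])
  have h3 := Q.ord_pos_of_mem hw0 hwQ
  have h4 : Q.ord (algebraMap _ _ t.1) = 1 + Q.ord (algebraMap _ _ w) := by
    rw [hw, map_mul, Q.ord_mul, ord_X_sub_X_eq_one hQ]
    · exact IsFractionRing.to_map_ne_zero_of_mem_nonZeroDivisors
        (mem_nonZeroDivisors_of_ne_zero (X_sub_X_ne_zero hij))
    · exact IsFractionRing.to_map_ne_zero_of_mem_nonZeroDivisors
        (mem_nonZeroDivisors_of_ne_zero hw0)
  have h5 : (1 : ℤ) = Q.ord (algebraMap _ _ t.1) := he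
  omega

theorem isMirror_of_ne_zero {B : QDivisor (invariantRing k G)} (h : IsCrepantBoundary k G B)
    {Q : PrimeDivisor (MvPolynomial (Fin n) k)} (hQ : B (Q.under (invariantRing k G)) ≠ 0) :
    IsMirror G Q := by
  by_contra hn
  have h1 := (isCrepantBoundary_iff B).mp h Q
  rw [mirrorMult_of_not_isMirror hn, Int.cast_zero] at h1
  refine mul_ne_zero ?_ hQ h1
  exact_mod_cast (ramificationIdx_pos G Q).ne'

theorem ramificationIdx_dvd_two {Q : PrimeDivisor (MvPolynomial (Fin n) k)} (h : IsMirror G Q) :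
    Q.asIdeal.ramificationIdx (invariantRing k G) ∣ 2 := by
  have h2 := ramificationIdx_mul_ord Q (discriminant_ne_zero (k := k) (G := G))
  rw [ord_discriminant, mirrorMult_of_isMirror h, mul_one] at h2
  have h3 : (Q.asIdeal.ramificationIdx (invariantRing k G) : ℤ) ∣ (2 : ℤ) := ⟨_, h2.symm⟩
  exact_mod_cast h3

theorem ramificationIdx_eq_one [CharP k 2] {Q : PrimeDivisor (MvPolynomial (Fin n) k)}
    (h : IsMirror G Q) : Q.asIdeal.ramificationIdx (invariantRing k G) = 1 := by
  have h2 := ramificationIdx_mul_ord Q (mirrorProduct_ne_zero (k := k) (G := G))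
  rw [ord_mirrorProduct, mirrorMult_of_isMirror h] at h2
  have h3 : (Q.asIdeal.ramificationIdx (invariantRing k G) : ℤ) ∣ (1 : ℤ) := ⟨_, h2.symm⟩
  exact Nat.dvd_one.mp (by exact_mod_cast h3)

theorem IsCrepantBoundary.eq_half {B : QDivisor (invariantRing k G)}
    (h : IsCrepantBoundary k G B) (h2 : (2 : k) ≠ 0) {P : PrimeDivisor (invariantRing k G)}
    (hP : B P ≠ 0) : B P = 1 / 2 := by
  obtain ⟨Q, rfl⟩ := PrimeDivisor.under_surjective (S := MvPolynomial (Fin n) k) P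
  have hQ := isMirror_of_ne_zero h hP
  have he := ((Nat.dvd_prime Nat.prime_two).mp (ramificationIdx_dvd_two hQ)).resolve_left
    (hQ.ramificationIdx_ne_one h2)
  have h1 := (isCrepantBoundary_iff B).mp h Q
  rw [he, mirrorMult_of_isMirror hQ] at h1
  push_cast at h1
  linarith

theorem IsCrepantBoundary.eq_one [CharP k 2] {B : QDivisor (invariantRing k G)}
    (h : IsCrepantBoundary k G B) {P : PrimeDivisor (invariantRing k G)}
    (hP : B P ≠ 0) : B P = 1 := by
  obtain ⟨Q, rfl⟩ := PrimeDivisor.under_surjective (S := MvPolynomial (Fin n) k) P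
  have hQ := isMirror_of_ne_zero h hP
  have h1 := (isCrepantBoundary_iff B).mp h Q
  rw [ramificationIdx_eq_one hQ, mirrorMult_of_isMirror hQ] at h1
  push_cast at h1
  linarith

theorem QDivisor.isCartier_of_forall_eq_ord {A : Type*} [CommRing A] [IsDomain A] {D : QDivisor A}
    {f : A} (hf : f ≠ 0) (h : ∀ P, D P = P.ord (algebraMap A (FractionRing A) f)) :
    D.IsCartier := fun x =>
  ⟨1, fun h1 => x.isPrime.ne_top ((Ideal.eq_top_iff_one _).mpr h1), _,
    IsFractionRing.to_map_ne_zero_of_mem_nonZeroDivisors (mem_nonZeroDivisors_of_ne_zero hf),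
    fun P _ => h P⟩

theorem IsCrepantBoundary.isNCartier_two {B : QDivisor (invariantRing k G)}
    (h : IsCrepantBoundary k G B) : QDivisor.IsNCartier 2 B :=
  QDivisor.isCartier_of_forall_eq_ord discriminant_ne_zero fun P => by
    rw [← two_mul_eq_ord_discriminant h, Finsupp.smul_apply, nsmul_eq_mul, Nat.cast_ofNat]

theorem IsCrepantBoundary.isCartier [CharP k 2] {B : QDivisor (invariantRing k G)}
    (h : IsCrepantBoundary k G B) : QDivisor.IsCartier B :=
  QDivisor.isCartier_of_forall_eq_ord mirrorProduct_ne_zero (eq_ord_mirrorProduct h)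

end Multiplicity

end

end PermQuotient

theorem lemma3p2 (k : Type*) [Field k] (p : ℕ) [CharP k p] (n : ℕ)
    (G : Subgroup (Equiv.Perm (Fin n))) :
    (∃! B : PermQuotient.QDivisor (PermQuotient.invariantRing k G),
      PermQuotient.IsBoundary k G B) ∧
    ∀ B : PermQuotient.QDivisor (PermQuotient.invariantRing k G),
      PermQuotient.IsBoundary k G B →
        (p ≠ 2 → ∀ P ∈ B.support, B P = 1 / 2) ∧
        (p = 2 → ∀ P ∈ B.support, B P = 1) ∧
        PermQuotient.QDivisor.IsNCartier 2 B ∧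
        (p = 2 → PermQuotient.QDivisor.IsCartier B) := by
  refine ⟨PermQuotient.existsUnique_isBoundary k G, fun B hB =>
    ⟨fun hp P hP => hB.2.eq_half ?_ (Finsupp.mem_support_iff.mp hP), ?_, hB.2.isNCartier_two, ?_⟩⟩
  · intro h2
    have hdvd := (CharP.cast_eq_zero_iff k p 2).mp (by exact_mod_cast h2)
    rcases (Nat.dvd_prime Nat.prime_two).mp hdvd with h | h
    · exact CharP.char_ne_one k p h
    · exact hp h
  · rintro rfl P hP
    exact hB.2.eq_one (Finsupp.mem_support_iff.mp hP)
  · rintro rfl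
    exact hB.2.isCartier
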